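/- Let $K$ be an algebraically closed field and let $\mathcal P$ be a disc with finitely many (at least two) marked points on its boundary. A diagonal of $\mathcal P$ is an arc through the interior of the disc joining two distinct marked points (possibly neighbouring ones), considered up to isotopy fixing the marked points. A tiling $\mathsf T$ of $\mathcal P$ is the dissection of the disc given by a set of pairwise non-isotopic, noncrossing diagonals; its tiles are the regions of this dissection. The length of a tile is the number of diagonals that bound it, and a tile is called open if part of its boundary lies on the boundary of the disc. The tiling algebra is $A_{\mathsf T}=KQ_{\mathsf T}/I_{\mathsf T}$, where the vertices of the quiver $Q_{\mathsf T}$ are the diagonals of $\mathsf T$; there is an arrow $\alpha\to\beta$ whenever the diagonals $\alpha$ and $\beta$ share a marked point $x$, bound a common tile, and the rotation around $x$ with minimal angle that sends $\alpha$ to $\beta$ is clockwise; and $I_{\mathsf T}$ is the two-sided ideal generated by the compositions of two successive arrows coming from the same tile. Assume that $A_{\mathsf T}$ is connected, i.e. that the underlying graph of $Q_{\mathsf T}$ is connected. Suppose that $\mathsf T$ has an open tile of length at least two, and let $k$ be the maximum length of an open tile of $\mathsf T$. Then $A_{\mathsf T}$ has Gorenstein dimension $k-1$; that is, the injective dimension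 of $A_{\mathsf T}$ as a left module over itself and its injective dimension as a right module over itself are both equal to $k-1$. -/

import Mathlib

open CategoryTheory

universe u

noncomputable section

/-! ### Path algebras -/

/-- The paths (of all lengths, including the trivial paths at the vertices) of a quiver. -/
structure QuiverPath (V : Type) [Quiver.{0} V] : Type where
  src : V
  tgt : V
  path : Quiver.Path src tgt

namespace QuiverPath

variable {V : Type} [Quiver.{0} V]

/-- The trivial path at `v`. -/
def trivial (v : V) : QuiverPath V := ⟨v, v, Quiver.Path.nil⟩

/-- The path `p` followed by the path `q` (paths are read from left to right). -/
def comp (p q : QuiverPath V) (h : p.tgt = q.src) : QuiverPath V :=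
  ⟨p.src, q.tgt, p.path.comp (q.path.cast h.symm rfl)⟩

lemma comp_assoc (p q r : QuiverPath V) (h : p.tgt = q.src) (h' : q.tgt = r.src) :
    (p.comp q h).comp r h' = p.comp (q.comp r h') h := by
  obtain ⟨a, b, p⟩ := p
  obtain ⟨b', c, q⟩ := q
  obtain ⟨c', d, r⟩ := r
  dsimp at h h'
  subst h h'
  simp [comp]

lemma trivial_comp (p : QuiverPath V) : (trivial p.src).comp p rfl = p := by
  simp [comp, trivial]

lemma comp_trivial (p : QuiverPath V) : p.comp (trivial p.tgt) rfl = p := by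
  simp [comp, trivial]

end QuiverPath

/-- The path algebra of the quiver `V`: the vector space with basis the paths of `V`. -/
def PathAlgebra (K : Type u) [Field K] (V : Type) [Quiver.{0} V] : Type u := QuiverPath V →₀ K

namespace PathAlgebra

variable (K : Type u) [Field K] {V : Type} [Quiver.{0} V]

instance : AddCommGroup (PathAlgebra K V) := inferInstanceAs (AddCommGroup (QuiverPath V →₀ K))

instance : Module K (PathAlgebra K V) := inferInstanceAs (Module K (QuiverPath V →₀ K))

/-- The basis vector of the path algebra given by a path. -/
def of (p : QuiverPath V) : PathAlgebra K V := Finsupp.single p (1 : K)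

/-- The linear extension of a map that is defined on paths. -/
def lift {M : Type*} [AddCommGroup M] [Module K M] (f : QuiverPath V → M) :
    PathAlgebra K V →ₗ[K] M :=
  Finsupp.linearCombination K f

@[simp] lemma lift_of {M : Type*} [AddCommGroup M] [Module K M] (f : QuiverPath V → M)
    (p : QuiverPath V) : lift K f (of K p) = f p :=
  (Finsupp.linearCombination_single K 1 p).trans (one_smul K (f p))

open Classical in
/-- The product of two paths: their concatenation if the first ends where the second starts, and
zero otherwise. -/
def mulPath (p q : QuiverPath V) : PathAlgebra K V :=
  if h : p.tgt = q.src then of K (p.comp q h) else 0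

/-- The bilinear extension of the product of paths. -/
def mulHom : PathAlgebra K V →ₗ[K] PathAlgebra K V →ₗ[K] PathAlgebra K V :=
  lift K fun p => lift K fun q => mulPath K p q

instance : Mul (PathAlgebra K V) := ⟨fun x y => mulHom K x y⟩

lemma mul_def (x y : PathAlgebra K V) : x * y = mulHom K x y := rfl

lemma of_mul_of (p q : QuiverPath V) : of K p * of K q = mulPath K p q := by
  simp [mul_def, mulHom]

lemma hom_ext {M : Type*} [AddCommMonoid M] [Module K M] {f g : PathAlgebra K V →ₗ[K] M}
    (h : ∀ p, f (of K p) = g (of K p)) : f = g :=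
  Finsupp.lhom_ext' fun p => LinearMap.ext_ring (h p)

lemma of_mul_assoc (p q r : QuiverPath V) :
    of K p * of K q * of K r = of K p * (of K q * of K r) := by
  simp only [of_mul_of, mulPath]
  by_cases h : p.tgt = q.src <;> by_cases h' : q.tgt = r.src
  · have h1 : (p.comp q h).tgt = r.src := h'
    have h2 : p.tgt = (q.comp r h').src := h
    simp only [h, h', dite_true, of_mul_of, mulPath, h1]
    rw [dif_pos h2]
    exact congrArg (of K) (QuiverPath.comp_assoc p q r h h')
  · have h1 : ¬ (p.comp q h).tgt = r.src := h'
    simp only [h, h', dite_true, dite_false, of_mul_of, mulPath, h1]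
    simp [mul_def]
  · have h2 : ¬ p.tgt = (q.comp r h').src := h
    simp only [h, h', dite_true, dite_false, of_mul_of, mulPath, h2]
    simp [mul_def]
  · simp [h, h', mul_def]

protected lemma mul_assoc (x y z : PathAlgebra K V) : x * y * z = x * (y * z) := by
  have key : (mulHom K (V := V)).compr₂ (mulHom K) =
      ((LinearMap.llcomp K _ _ _).comp (mulHom K (V := V))).compl₂ (mulHom K) := by
    refine hom_ext K fun p => hom_ext K fun q => hom_ext K fun r => ?_
    exact of_mul_assoc K p q r
  exact LinearMap.congr_fun (LinearMap.congr_fun (LinearMap.congr_fun key x) y) z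

variable [Fintype V]

/-- The unit of the path algebra is the sum of all trivial paths. -/
instance : One (PathAlgebra K V) := ⟨∑ v : V, of K (QuiverPath.trivial v)⟩

lemma one_def : (1 : PathAlgebra K V) = ∑ v : V, of K (QuiverPath.trivial v) := rfl

protected lemma one_mul (x : PathAlgebra K V) : 1 * x = x := by
  have key : mulHom K (1 : PathAlgebra K V) = LinearMap.id := by
    refine hom_ext K fun p => ?_
    simp only [one_def, map_sum, LinearMap.sum_apply, LinearMap.id_apply]
    rw [Finset.sum_eq_single p.src]
    · rw [← mul_def, of_mul_of, mulPath, dif_pos (show (QuiverPath.trivial p.src).tgt = p.src from rfl),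
        QuiverPath.trivial_comp]
    · intro v _ hv
      rw [← mul_def, of_mul_of, mulPath, dif_neg (show ¬ (QuiverPath.trivial v).tgt = p.src from hv)]
    · simp
  exact LinearMap.congr_fun key x

protected lemma mul_one (x : PathAlgebra K V) : x * 1 = x := by
  have key : (mulHom K (V := V)).flip 1 = LinearMap.id := by
    refine hom_ext K fun p => ?_
    simp only [one_def, map_sum, LinearMap.sum_apply, LinearMap.id_apply, LinearMap.flip_apply]
    rw [Finset.sum_eq_single p.tgt]
    · rw [← mul_def, of_mul_of, mulPath, dif_pos (show p.tgt = (QuiverPath.trivial p.tgt).src from rfl),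
        QuiverPath.comp_trivial]
    · intro v _ hv
      rw [← mul_def, of_mul_of, mulPath,
        dif_neg (show ¬ p.tgt = (QuiverPath.trivial v).src from fun h => hv h.symm)]
    · simp
  exact LinearMap.congr_fun key x

instance : Ring (PathAlgebra K V) where
  __ := (inferInstance : AddCommGroup (PathAlgebra K V))
  mul_assoc := PathAlgebra.mul_assoc K
  one_mul := PathAlgebra.one_mul K
  mul_one := PathAlgebra.mul_one K
  left_distrib x y z := by simp [mul_def]
  right_distrib x y z := by simp [mul_def]
  zero_mul x := by simp [mul_def]
  mul_zero x := by simp [mul_def]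

instance : Algebra K (PathAlgebra K V) :=
  Algebra.ofModule (fun r x y => by simp [mul_def]) (fun r x y => by simp [mul_def])

end PathAlgebra

/-! ### Tilings of a marked disc

The disc has `n` marked points on its boundary circle, numbered `0, …, n - 1` in clockwise order.
A diagonal is an arc through the interior of the disc joining two different marked points; up to
isotopy it is the unordered pair of its endpoints. The endpoints may be neighbours on the boundary:
such a diagonal is different from the boundary segment between them. -/

namespace MarkedDisc

/-- The marked points cut the boundary circle into marked points and open boundary segments;
`segment i` runs clockwise from the marked point `i` to the next marked point. -/
inductive BoundaryPiece (n : ℕ) : Type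
  | point (i : Fin n) : BoundaryPiece n
  | segment (i : Fin n) : BoundaryPiece n

/-- The position of a boundary piece in the clockwise circular order
`point 0, segment 0, point 1, segment 1, …, point (n - 1), segment (n - 1)`. -/
def BoundaryPiece.pos {n : ℕ} : BoundaryPiece n → Fin (2 * n)
  | .point i => ⟨2 * i, by omega⟩
  | .segment i => ⟨2 * i + 1, by omega⟩

/-- Two diagonals cross if the endpoints of the second lie strictly on different sides of the
first. Here `sbtw a b c` says that `a, b, c` are distinct and in clockwise circular order. -/
def Crosses {n : ℕ} (d e : Sym2 (Fin n)) : Prop :=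
  ∃ a b x y : Fin n, d = s(a, b) ∧ e = s(x, y) ∧ sbtw a x b ∧ sbtw b y a

/-- The diagonal `d` separates two boundary pieces if they lie strictly on different sides of
`d`. -/
def Separates {n : ℕ} (d : Sym2 (Fin n)) (p q : BoundaryPiece n) : Prop :=
  ∃ a b : Fin n, d = s(a, b) ∧
    sbtw (BoundaryPiece.point a).pos p.pos (BoundaryPiece.point b).pos ∧
    sbtw (BoundaryPiece.point b).pos q.pos (BoundaryPiece.point a).pos

/-- A tiling of the disc with `n` marked points, given by a set of pairwise noncrossing
diagonals. -/
structure Tiling (n : ℕ) where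
  diagonals : Finset (Sym2 (Fin n))
  endpoints_ne : ∀ d ∈ diagonals, ¬ d.IsDiag
  noncrossing : ∀ d ∈ diagonals, ∀ e ∈ diagonals, ¬ Crosses d e

namespace Tiling

variable {n : ℕ} (T : Tiling n)

/-- The tiles of `T` are the closed regions into which the diagonals cut the disc. A tile is
recorded by the set of boundary pieces that it contains; these sets are exactly the maximal sets
of boundary pieces no two of which are separated by a diagonal. (Every tile contains at least
three pieces, and so it is determined by them.) -/
def IsTile (R : Set (BoundaryPiece n)) : Prop :=
  Maximal (fun S : Set (BoundaryPiece n) =>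
    ∀ p ∈ S, ∀ q ∈ S, ∀ d ∈ T.diagonals, ¬ Separates d p q) R

/-- The diagonal `d` of `T` bounds the tile `R`, i.e. both endpoints of `d` lie in `R`. -/
def Bounds (d : Sym2 (Fin n)) (R : Set (BoundaryPiece n)) : Prop :=
  d ∈ T.diagonals ∧ ∀ a ∈ d, BoundaryPiece.point a ∈ R

/-- A tile is open if a part of its boundary lies on the boundary circle of the disc. -/
def IsOpenTile (R : Set (BoundaryPiece n)) : Prop :=
  T.IsTile R ∧ ∃ i : Fin n, BoundaryPiece.segment i ∈ R

/-- The length of a tile is the number of diagonals which bound it. -/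
def tileLength (R : Set (BoundaryPiece n)) : ℕ :=
  Set.ncard {d | T.Bounds d R}

/-! ### The tiling algebra -/

/-- The vertices of the quiver of `T` are the diagonals of `T`. -/
def Vertex : Type := {d : Sym2 (Fin n) // d ∈ T.diagonals}

instance : Fintype T.Vertex := inferInstanceAs (Fintype {d // d ∈ T.diagonals})

/-- There is an arrow `d ⟶ e` if `d` and `e` share an endpoint `x`, bound a common tile, and the
rotation around `x` through the minimal angle that sends `d = {x, a}` to `e = {x, b}` is
clockwise, i.e. `x, a, b` are in clockwise order on the boundary. -/
def IsArrow (d e : T.Vertex) : Prop :=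
  (∃ R, T.IsTile R ∧ T.Bounds d.1 R ∧ T.Bounds e.1 R) ∧
    ∃ x a b : Fin n, d.1 = s(x, a) ∧ e.1 = s(x, b) ∧ sbtw x a b

instance : Quiver.{0} T.Vertex where
  Hom d e := PLift (T.IsArrow d e)

/-- The relations: the compositions of two successive arrows `d ⟶ e ⟶ f` that come from the same
tile. -/
def relations (K : Type u) [Field K] : Set (PathAlgebra K T.Vertex) :=
  {r | ∃ (d e f : T.Vertex) (α : d ⟶ e) (β : e ⟶ f),
    (∃ R, T.IsTile R ∧ T.Bounds d.1 R ∧ T.Bounds e.1 R ∧ T.Bounds f.1 R) ∧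
    r = PathAlgebra.of K ⟨d, f, α.toPath.comp β.toPath⟩}

/-- The tiling algebra of `T` over `K`: the path algebra of the quiver of `T` modulo the two-sided
ideal generated by the relations. -/
abbrev tilingAlgebra (K : Type u) [Field K] : Type u :=
  (TwoSidedIdeal.span (T.relations K)).ringCon.Quotient

/-- The tiling algebra of `T` is connected, i.e. any two vertices of its quiver are joined by an
unoriented path. -/
def IsConnected : Prop := Subsingleton (Quiver.WeaklyConnectedComponent T.Vertex)

end Tiling

end MarkedDisc

/-! ### Gorenstein dimension -/

/-- The ring `A` has Gorenstein dimension `d`: the injective dimensions of `A` as a left module and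
as a right module over itself are both equal to `d`. -/
def HasGorensteinDimension (A : Type u) [Ring A] (d : ℕ) : Prop :=
  injectiveDimension (ModuleCat.of A A) = (d : WithBot ℕ∞) ∧
    injectiveDimension (ModuleCat.of Aᵐᵒᵖ A) = (d : WithBot ℕ∞)

end

/-!
A diagonal of a tiling `T` has two *darts*, one for each endpoint. The darts at a marked point form
a *fan*, which is linearly ordered clockwise. The nonzero paths of the quiver of `T` modulo the
relations are those that turn around a single marked point, so that the tiling algebra `A` is
isomorphic to the algebra of the matrices, indexed by the darts, that are upper triangular on each
fan, vanish outside of the fans, and have equal diagonal entries at the two darts of each diagonal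
(`MarkedDisc.Tiling.realization`). The rest of the homological argument only uses this description,
which is isolated in the notions of a `FanSystem` and of its `Realization`.

The algebra acts on column vectors. For a dart `p` let `Q p`, which is `R.Quot (UpperSet.Ici p)`
below, be the module of the vectors with entries at the darts `q ≥ p`, a quotient of the module of
all column vectors. Write `p'` for the other dart of the diagonal of `p`. The injective module of
this diagonal is glued from `Q p` and `Q p'` along their socles, so there is a short exact sequence
`0 → Q p → I → Q q → 0` with injective middle term, where `q` is the successor of `p'` in its fan,
and `Q q` is replaced by `0` if there is none.
Hence the injective dimension of `Q p` is `l - 1`, where `l` is the length of the chain of darts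
that is obtained from `p` by iterating the step from `p` to `q`
(`FanSystem.Realization.injDimLT_of_chain`). On the other hand, the columns of the matrices embed
`A` in a product of modules `Q p` with `p` at the bottom of a fan, and the cokernel is the injective
module `Hom_K(A, K)`, by means of a trace form with signs that are opposite at the two darts of a
diagonal (`FanSystem.Realization.exact_columns_alternatingTrace`). So if the longest chain that
starts at the bottom of a fan has length `k ≥ 2`, then `A` has injective dimension `k - 1`. The
opposite algebra belongs to the fan system with reversed fans, whose chains are the chains of the
original one read backwards (`FanSystem.Chain.reverse`).

Finally, a chain that starts at the bottom of a fan runs along the boundary of an open tile, one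
diagonal after the other (`MarkedDisc.Tiling.exists_isOpenTile_of_chain`), and it exhausts the
diagonals of this tile if the quiver is connected (`MarkedDisc.Tiling.exists_chain_of_isOpenTile`).
-/

noncomputable section

/-! ### Injective dimension of modules -/

section InjectiveDimension

variable {A : Type u} [Ring A]

/-- The injective dimension of the module `M` is less than `n`. -/
abbrev InjDimLT (A : Type u) [Ring A] (M : Type u) [AddCommGroup M] [Module A M] (n : ℕ) : Prop :=
  HasInjectiveDimensionLT (ModuleCat.of A M) n

variable {M N P : Type u} [AddCommGroup M] [Module A M] [AddCommGroup N] [Module A N]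
  [AddCommGroup P] [Module A P]

lemma injDimLT_one_iff : InjDimLT A M 1 ↔ Module.Injective A M := by
  rw [Module.injective_iff_injective_object, injective_iff_hasInjectiveDimensionLT_one]

lemma injDimLT_zero_iff : InjDimLT A M 0 ↔ Subsingleton M := by
  rw [InjDimLT, hasInjectiveDimensionLT_zero_iff_isZero, ModuleCat.isZero_iff_subsingleton]

lemma InjDimLT.mono {m n : ℕ} (h : InjDimLT A M m) (hmn : m ≤ n) : InjDimLT A M n :=
  hasInjectiveDimensionLT_of_ge _ m n hmn

lemma InjDimLT.of_retract {n : ℕ} (h : InjDimLT A N n) (i : M →ₗ[A] N) (r : N →ₗ[A] M)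
    (hri : ∀ x, r (i x) = x) : InjDimLT A M n := by
  have : HasInjectiveDimensionLT (ModuleCat.of A N) n := h
  refine Retract.hasInjectiveDimensionLT (Y := ModuleCat.of A N)
    ⟨ModuleCat.ofHom i, ModuleCat.ofHom r, ?_⟩ n
  ext x
  exact hri x

section ShortExact

variable (f : M →ₗ[A] N) (g : N →ₗ[A] P) (hf : Function.Injective f) (hg : Function.Surjective g)
  (hfg : Function.Exact f g)
include hf hg hfg

lemma shortExact_of_exact :
    (ModuleCat.shortComplexOfCompEqZero f g hfg.linearMap_comp_eq_zero).ShortExact :=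
  ModuleCat.shortComplex_shortExact
    (ModuleCat.shortComplexOfCompEqZero f g hfg.linearMap_comp_eq_zero) hfg hf hg

lemma injDimLT_middle {n : ℕ} (h₁ : InjDimLT A M n) (h₃ : InjDimLT A P n) : InjDimLT A N n :=
  (shortExact_of_exact f g hf hg hfg).hasInjectiveDimensionLT_X₂ n h₁ h₃

lemma injDimLT_left {n : ℕ} (h₂ : InjDimLT A N (n + 1)) (h₃ : InjDimLT A P n) :
    InjDimLT A M (n + 1) :=
  (shortExact_of_exact f g hf hg hfg).hasInjectiveDimensionLT_X₁ n h₃ h₂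

lemma injDimLT_right {n : ℕ} (h₁ : InjDimLT A M (n + 1)) (h₂ : InjDimLT A N n) :
    InjDimLT A P n :=
  (shortExact_of_exact f g hf hg hfg).hasInjectiveDimensionLT_X₃ n h₂ h₁

end ShortExact

/-- The injective dimension of a product of modules is at most the supremum of the injective
dimensions of the factors. -/
lemma injDimLT_pi {ι : Type} (n : ℕ) (M : ι → Type u) [∀ i, AddCommGroup (M i)]
    [∀ i, Module A (M i)] (h : ∀ i, InjDimLT A (M i) n) : InjDimLT A (∀ i, M i) n := by
  induction n using Nat.twoStepInduction generalizing M with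
  | zero =>
    simp only [injDimLT_zero_iff] at h ⊢
    infer_instance
  | one =>
    simp only [injDimLT_one_iff] at h ⊢
    infer_instance
  | more n _ ih =>
    let I (i : ι) : InjectivePresentation (ModuleCat.of A (M i)) :=
      (EnoughInjectives.presentation _).some
    let J (i : ι) : Type u := (I i).J
    let f (i : ι) : M i →ₗ[A] J i := (I i).f.hom
    have hf (i : ι) : Function.Injective (f i) := (ModuleCat.mono_iff_injective _).1 (I i).mono
    have hJ (i : ι) : Module.Injective A (J i) :=
      (Module.injective_iff_injective_object A (J i)).2 (I i).injective
    have hJ' (i : ι) : InjDimLT A (J i) 1 := injDimLT_one_iff.2 (hJ i)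
    have hC (i : ι) : InjDimLT A (J i ⧸ LinearMap.range (f i)) (n + 1) :=
      injDimLT_right (f i) (Submodule.mkQ _) (hf i) (Submodule.mkQ_surjective _)
        (LinearMap.exact_map_mkQ_range _) (h i) ((hJ' i).mono (by omega))
    refine injDimLT_left (n := n + 1) (LinearMap.pi fun i => f i ∘ₗ LinearMap.proj i)
      (LinearMap.pi fun i => (LinearMap.range (f i)).mkQ ∘ₗ LinearMap.proj i)
      ?_ ?_ ?_ ((injDimLT_one_iff.2 inferInstance : InjDimLT A (∀ i, J i) 1).mono (by omega))
      (ih _ hC)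
    · intro x y hxy
      funext i
      exact hf i (congrFun hxy i)
    · intro y
      choose z hz using fun i => Submodule.mkQ_surjective (LinearMap.range (f i)) (y i)
      exact ⟨z, funext hz⟩
    · intro y
      constructor
      · intro hy
        have : ∀ i, ∃ x, f i x = y i := fun i => by
          have := congrFun hy i
          simpa using this
        choose x hx using this
        exact ⟨x, funext hx⟩
      · rintro ⟨x, rfl⟩
        funext i
        simp

lemma injectiveDimension_eq_of_injDimLT {n : ℕ} (h : InjDimLT A M (n + 1))
    (h' : ¬ InjDimLT A M n) : injectiveDimension (ModuleCat.of A M) = (n : WithBot ℕ∞) :=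
  le_antisymm ((injectiveDimension_le_iff _ n).2 h) ((injectiveDimension_ge_iff _ n).2 h')

end InjectiveDimension

/-! ### Coinduced modules -/

/-- The module `Hom_K(A, K)` over the `K`-algebra `A`, with the action `(a • f) b = f (b * a)`. -/
def DualModule (K A : Type u) [Field K] [Ring A] [Algebra K A] : Type u := A →ₗ[K] K

namespace DualModule

variable (K A : Type u) [Field K] [Ring A] [Algebra K A]

instance : AddCommGroup (DualModule K A) := inferInstanceAs (AddCommGroup (A →ₗ[K] K))

instance : FunLike (DualModule K A) A K := inferInstanceAs (FunLike (A →ₗ[K] K) A K)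

instance : LinearMapClass (DualModule K A) K A K :=
  inferInstanceAs (LinearMapClass (A →ₗ[K] K) K A K)

instance : Module A (DualModule K A) where
  smul a f := LinearMap.comp (show A →ₗ[K] K from f) (LinearMap.mulRight K a)
  one_smul f := LinearMap.ext fun b => congrArg f (mul_one b)
  mul_smul a a' f := LinearMap.ext fun b => congrArg f (mul_assoc b a a').symm
  smul_zero _ := rfl
  smul_add _ _ _ := rfl
  add_smul a a' f := LinearMap.ext fun b =>
    (congrArg f (mul_add b a a')).trans (map_add f _ _)
  zero_smul f := LinearMap.ext fun b => (congrArg f (mul_zero b)).trans (map_zero f)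

variable {K A}

@[ext] lemma ext {f g : DualModule K A} (h : ∀ a, f a = g a) : f = g := LinearMap.ext h

@[simp] lemma smul_apply (a b : A) (f : DualModule K A) : (a • f) b = f (b * a) := rfl
@[simp] lemma add_apply (b : A) (f g : DualModule K A) : (f + g) b = f b + g b := rfl

variable {M : Type u} [AddCommGroup M] [Module A M] [Module K M] [IsScalarTower K A M]

/-- The homomorphism into the coinduced module that corresponds to a linear functional. -/
def homOfFunctional (t : M →ₗ[K] K) : M →ₗ[A] DualModule K A where
  toFun m := (t ∘ₗ (LinearMap.toSpanSingleton A M m).restrictScalars K : A →ₗ[K] K)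
  map_add' m m' := LinearMap.ext fun b => (congrArg t (smul_add b m m')).trans (map_add t _ _)
  map_smul' a m := LinearMap.ext fun b => by
    change t (b • a • m) = t ((b * a) • m)
    rw [mul_smul]

@[simp] lemma homOfFunctional_apply (t : M →ₗ[K] K) (m : M) (b : A) :
    homOfFunctional t m b = t (b • m) := rfl

instance injective : Module.Injective A (DualModule K A) where
  out X Y _ _ _ _ f hf g := by
    let _ : Module K X := Module.compHom X (algebraMap K A)
    let _ : Module K Y := Module.compHom Y (algebraMap K A)
    have : IsScalarTower K A X := ⟨fun k a x => by
      rw [Algebra.smul_def, mul_smul]; rfl⟩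
    have : IsScalarTower K A Y := ⟨fun k a x => by
      rw [Algebra.smul_def, mul_smul]; rfl⟩
    obtain ⟨r, hr⟩ := (f.restrictScalars K).exists_leftInverse_of_injective
      (LinearMap.ker_eq_bot.2 hf)
    let t : X →ₗ[K] K :=
      { toFun := fun x => g x 1
        map_add' := fun x y => by simp
        map_smul' := fun k x => by
          have : k • x = algebraMap K A k • x := rfl
          rw [this, map_smul, smul_apply, one_mul, Algebra.algebraMap_eq_smul_one, map_smul]
          rfl }
    refine ⟨homOfFunctional (t ∘ₗ r), fun x => ?_⟩
    ext b
    have : r (f (b • x)) = b • x := LinearMap.congr_fun hr (b • x)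
    simp only [homOfFunctional_apply, LinearMap.comp_apply, ← map_smul, this]
    change g (b • x) 1 = _
    simp

end DualModule

/-! ### Fan systems -/

/-- A fan system on a finite set `D` of darts (half-edges): the darts fall into fans, which are the
classes of comparable elements of the partial order of `D`, and the fixpoint free involution `swap`
pairs each dart with the other half of its edge, which lies in a different fan. An edge is oriented
by giving opposite signs to its two darts. -/
structure FanSystem (D : Type) [PartialOrder D] where
  swap : D → D
  swap_swap : ∀ p, swap (swap p) = p
  comparable_trans : ∀ p q r : D, p ≤ q ∨ q ≤ p → q ≤ r ∨ r ≤ q → p ≤ r ∨ r ≤ p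
  not_comparable_swap : ∀ p, ¬ (p ≤ swap p ∨ swap p ≤ p)
  sign : D → ℤˣ
  sign_swap : ∀ p, sign (swap p) = - sign p

namespace FanSystem

variable {D : Type} [PartialOrder D] (F : FanSystem D)

lemma swap_ne (p : D) : F.swap p ≠ p := fun h => F.not_comparable_swap p (Or.inl h.ge)

lemma swap_injective : Function.Injective F.swap := fun p q h => by
  rw [← F.swap_swap p, h, F.swap_swap]

/-- Nothing lies above both darts of an edge. -/
lemma not_le_of_swap_le {p q : D} (h : F.swap p ≤ q) : ¬ p ≤ q := fun h' =>
  F.not_comparable_swap p (F.comparable_trans p q _ (Or.inl h') (Or.inr h))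

/-- The fan system with all fans reversed. -/
def reverse : FanSystem Dᵒᵈ where
  swap := F.swap
  swap_swap := F.swap_swap
  comparable_trans p q r h h' :=
    (F.comparable_trans p.ofDual q.ofDual r.ofDual h.symm h'.symm).symm
  not_comparable_swap p h := F.not_comparable_swap p.ofDual h.symm
  sign := F.sign
  sign_swap := F.sign_swap

/-- `F.Chain p l` says that the sequence of darts that starts at `p` and moves on from each dart
`q` to the dart that covers `F.swap q` stops after `l` darts. -/
inductive Chain : D → ℕ → Prop
  | one (p : D) : (∀ q, ¬ F.swap p < q) → Chain p 1
  | succ (p q : D) (l : ℕ) : F.swap p ⋖ q → Chain q l → Chain p (l + 1)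

/-- The elements of the fan of `q`. -/
def fan (q : D) : UpperSet D where
  carrier := {r | r ≤ q ∨ q ≤ r}
  upper' r s hrs hr := F.comparable_trans s r q (Or.inr hrs) hr

@[simp] lemma mem_fan {q r : D} : r ∈ F.fan q ↔ r ≤ q ∨ q ≤ r := Iff.rfl

lemma fan_eq_Ici {p q : D} (hp : ∀ r, ¬ r < p) (hpq : p ≤ q) : F.fan q = UpperSet.Ici p := by
  ext r
  simp only [SetLike.mem_coe, mem_fan, UpperSet.mem_Ici_iff]
  constructor
  · intro h
    rcases F.comparable_trans p q r (Or.inl hpq) h.symm with h | h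
    · exact h
    · exact (h.lt_or_eq.resolve_left (hp r)).ge
  · exact fun h => F.comparable_trans r p q (Or.inr h) (Or.inl hpq)

lemma Ioi_eq_Ici (F : FanSystem D) {p q : D} (h : p ⋖ q) : UpperSet.Ioi p = UpperSet.Ici q := by
  ext r
  simp only [SetLike.mem_coe, UpperSet.mem_Ici_iff, UpperSet.mem_Ioi_iff]
  constructor
  · intro hr
    rcases F.comparable_trans q p r (Or.inr h.le) (Or.inl hr.le) with h' | h'
    · exact h'
    · exact (h'.lt_or_eq.resolve_left fun h'' => h.2 hr h'').ge
  · exact fun hr => h.lt.trans_le hr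

lemma Chain.pos {p : D} {l : ℕ} (h : F.Chain p l) : 1 ≤ l := by
  cases h <;> omega

section Matrix

variable [Fintype D] [DecidableEq D]

/-- The matrix of the idempotent that belongs to the edge of `p`. -/
def edgeMatrix (K : Type u) [Field K] (p : D) : Matrix D D K :=
  Matrix.diagonal fun q => if q = p ∨ q = F.swap p then 1 else 0

open scoped Classical in
/-- The expansion of a matrix of the realized algebra in the basis that consists of the matrix units
at the pairs `p < q` and of one idempotent for each edge. -/
lemma matrix_eq_sum {K : Type u} [Field K] (M : Matrix D D K) (hM : ∀ p q, M p q ≠ 0 → p ≤ q)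
    (hswap : ∀ p, M (F.swap p) (F.swap p) = M p p) :
    M = ∑ p, ((∑ q, M p q • (if p < q then Matrix.single p q (1 : K) else 0)) +
      if F.sign p = 1 then M p p • F.edgeMatrix K p else 0) := by
  have h₀ (p q r s : D) : (if p < q then Matrix.single p q (1 : K) else 0) r s =
      if p < q ∧ p = r ∧ q = s then 1 else 0 := by
    by_cases h : p < q <;> simp [h, Matrix.single_apply]
  ext r s
  simp only [Matrix.sum_apply, Matrix.add_apply, Matrix.smul_apply, h₀, smul_eq_mul,
    Finset.sum_add_distrib]
  have h₁ : ∑ p, ∑ q, M p q * (if p < q ∧ p = r ∧ q = s then 1 else 0) =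
      if r < s then M r s else 0 := by
    rw [Finset.sum_eq_single r, Finset.sum_eq_single s]
    · simp
    · intro q _ hq
      simp [hq]
    · simp
    · intro p _ hp
      simp [hp]
    · simp
  have h₂ (p : D) : (if F.sign p = 1 then M p p • F.edgeMatrix K p else 0) r s =
      if F.sign p = 1 ∧ r = s ∧ (r = p ∨ r = F.swap p) then M r r else 0 := by
    split_ifs with h h' h'
    · obtain ⟨-, rfl, h'⟩ := h'
      rw [Matrix.smul_apply, edgeMatrix, Matrix.diagonal_apply_eq, if_pos h', smul_eq_mul, mul_one]
      obtain rfl | rfl := h'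
      · rfl
      · rw [hswap]
    · rw [Matrix.smul_apply, edgeMatrix, smul_eq_mul]
      by_cases hrs : r = s
      · subst hrs
        rw [Matrix.diagonal_apply_eq, if_neg fun h'' => h' ⟨h, rfl, h''⟩, mul_zero]
      · rw [Matrix.diagonal_apply_ne _ hrs, mul_zero]
    · exact absurd h'.1 h
    · rfl
  simp only [h₁, h₂]
  by_cases hrs : r = s
  · subst hrs
    simp only [lt_irrefl, if_false, zero_add, true_and]
    -- exactly one of the two darts of an edge is positive
    obtain h | h := Int.units_eq_one_or (F.sign r)
    · rw [Finset.sum_eq_single r]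
      · simp [h]
      · intro p _ hp
        refine if_neg ?_
        rintro ⟨hp', rfl | rfl⟩
        · exact hp rfl
        · rw [F.sign_swap, hp'] at h
          exact absurd h (by decide)
      · simp
    · rw [Finset.sum_eq_single (F.swap r)]
      · simp [F.swap_swap, F.sign_swap, h]
      · intro p _ hp
        refine if_neg ?_
        rintro ⟨hp', rfl | rfl⟩
        · rw [hp'] at h
          exact absurd h (by decide)
        · exact hp (F.swap_swap p).symm
      · simp
  · simp only [hrs, false_and, and_false, if_false, Finset.sum_const_zero, add_zero]
    split_ifs with h
    · rfl
    · by_contra h'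
      exact h (lt_of_le_of_ne (hM r s h') hrs)

end Matrix

/-- A realization of a fan system over `K` is an algebra `A` together with an isomorphism of `A`
onto the algebra of the matrices that are upper triangular on each fan, vanish outside of the fans,
and have the same diagonal entry at the two darts of each edge. -/
structure Realization [Fintype D] [DecidableEq D] (K A : Type u) [Field K] [Ring A]
    [Algebra K A] where
  toMatrix : A →ₐ[K] Matrix D D K
  injective : Function.Injective toMatrix
  le_of_ne_zero : ∀ a p q, toMatrix a p q ≠ 0 → p ≤ q
  apply_swap : ∀ a p, toMatrix a (F.swap p) (F.swap p) = toMatrix a p p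
  exists_eq : ∀ M : Matrix D D K, (∀ p q, M p q ≠ 0 → p ≤ q) →
    (∀ p, M (F.swap p) (F.swap p) = M p p) → ∃ a, toMatrix a = M

namespace Realization

open scoped Classical

variable {F} [Fintype D] [DecidableEq D] {K A : Type u} [Field K] [Ring A] [Algebra K A]
  (R : F.Realization K A)

/-- The opposite algebra realizes the reversed fan system, by transposed matrices. -/
def op : F.reverse.Realization K Aᵐᵒᵖ where
  toMatrix :=
    { toFun := fun a => Matrix.of fun p q : Dᵒᵈ => R.toMatrix a.unop q.ofDual p.ofDual
      map_one' := by
        ext p q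
        simp only [MulOpposite.unop_one, map_one, Matrix.of_apply, Matrix.one_apply]
        exact if_congr eq_comm rfl rfl
      map_mul' := fun a b => by
        ext p q
        simp only [MulOpposite.unop_mul, map_mul, Matrix.of_apply, Matrix.mul_apply]
        exact Finset.sum_congr rfl fun r _ => mul_comm _ _
      map_zero' := by ext p q; simp
      map_add' := fun a b => by ext p q; simp
      commutes' := fun k => by
        ext p q
        simp only [MulOpposite.algebraMap_apply, MulOpposite.unop_op, AlgHom.commutes,
          Matrix.of_apply, Matrix.algebraMap_matrix_apply]
        exact if_congr eq_comm rfl rfl }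
  injective a b h := MulOpposite.unop_injective <| R.injective <| by
    ext p q
    exact congrFun (congrFun h q) p
  le_of_ne_zero a p q h := R.le_of_ne_zero a.unop q.ofDual p.ofDual h
  apply_swap a p := R.apply_swap a.unop p.ofDual
  exists_eq M h h' := by
    obtain ⟨a, ha⟩ := R.exists_eq (Matrix.of fun p q : D => M q p) (fun p q hpq => h q p hpq)
      fun p => h' p
    refine ⟨MulOpposite.op a, ?_⟩
    ext p q
    exact congrFun (congrFun ha q) p

lemma exists_unit (p q : D) :
    ∃ a, R.toMatrix a = if p < q then Matrix.single p q 1 else 0 := by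
  split_ifs with h
  · refine R.exists_eq _ (fun r s hrs => ?_) fun r => ?_
    · by_contra hle
      refine hrs (Matrix.single_apply_of_ne _ _ _ _ _ ?_)
      rintro ⟨rfl, rfl⟩
      exact hle h.le
    · rw [Matrix.single_apply_of_ne, Matrix.single_apply_of_ne]
      · rintro ⟨rfl, rfl⟩
        exact h.false
      · rintro ⟨rfl, h'⟩
        rw [h'] at h
        exact h.false
  · exact ⟨0, map_zero _⟩

/-- The element of `A` that corresponds to the matrix unit at `(p, q)` if `p < q`, and zero
otherwise. -/
def unit (p q : D) : A := (R.exists_unit p q).choose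

lemma toMatrix_unit (p q : D) :
    R.toMatrix (R.unit p q) = if p < q then Matrix.single p q 1 else 0 :=
  (R.exists_unit p q).choose_spec

lemma exists_idem (p : D) : ∃ a, R.toMatrix a = F.edgeMatrix K p := by
  refine R.exists_eq _ (fun r s hrs => ?_) fun r => ?_
  · by_contra hle
    exact hrs (Matrix.diagonal_apply_ne _ fun h => hle h.le)
  · simp only [edgeMatrix, Matrix.diagonal_apply_eq]
    refine if_congr ?_ rfl rfl
    rw [F.swap_injective.eq_iff, or_comm]
    refine or_congr Iff.rfl ⟨fun h => ?_, fun h => ?_⟩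
    · rw [← h, F.swap_swap]
    · rw [h, F.swap_swap]

/-- The idempotent of `A` that belongs to the edge of `p`. -/
def idem (p : D) : A := (R.exists_idem p).choose

lemma toMatrix_idem (p : D) : R.toMatrix (R.idem p) = F.edgeMatrix K p :=
  (R.exists_idem p).choose_spec

lemma toMatrix_unit_apply (p q r s : D) :
    R.toMatrix (R.unit p q) r s = if p < q ∧ p = r ∧ q = s then 1 else 0 := by
  rw [toMatrix_unit]
  by_cases h : p < q <;> simp [h, Matrix.single_apply]

lemma eq_zero_of_not_le (a : A) {p q : D} (h : ¬ p ≤ q) : R.toMatrix a p q = 0 :=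
  not_not.1 fun h' => h (R.le_of_ne_zero a p q h')

/-- The expansion of an element in the basis that consists of the matrix units `R.unit p q` with
`p < q` and of one idempotent for each edge. -/
lemma eq_sum (b : A) : b = ∑ p, ((∑ q, R.toMatrix b p q • R.unit p q) +
    if F.sign p = 1 then R.toMatrix b p p • R.idem p else 0) := by
  refine R.injective ?_
  conv_lhs => rw [F.matrix_eq_sum _ (R.le_of_ne_zero b) (R.apply_swap b)]
  simp only [map_sum, map_add, map_smul, toMatrix_unit]
  refine Finset.sum_congr rfl fun p _ => congrArg _ ?_
  split_ifs
  · rw [map_smul, toMatrix_idem]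
  · rw [map_zero]

/-! ### Column modules -/

/-- The space of column vectors with entries indexed by the darts, as a module over `A`. -/
def Col (_R : F.Realization K A) : Type u := D → K

instance : AddCommGroup R.Col := inferInstanceAs (AddCommGroup (D → K))
instance : Module K R.Col := inferInstanceAs (Module K (D → K))
instance : Module A R.Col where
  smul a v := (R.toMatrix a).mulVec v
  one_smul (v : D → K) := by
    change (R.toMatrix 1).mulVec v = v
    rw [map_one, Matrix.one_mulVec]
  mul_smul a b (v : D → K) := by
    change (R.toMatrix (a * b)).mulVec v = (R.toMatrix a).mulVec ((R.toMatrix b).mulVec v)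
    rw [map_mul, Matrix.mulVec_mulVec]
  smul_zero _ := Matrix.mulVec_zero _
  smul_add _ _ _ := Matrix.mulVec_add _ _ _
  add_smul a b (v : D → K) := by
    change (R.toMatrix (a + b)).mulVec v = (R.toMatrix a).mulVec v + (R.toMatrix b).mulVec v
    rw [map_add, Matrix.add_mulVec]
  zero_smul (v : D → K) := by
    change (R.toMatrix 0).mulVec v = 0
    rw [map_zero, Matrix.zero_mulVec]

instance : FunLike R.Col D K := ⟨id, Function.injective_id⟩

/-- The column vector with the given entries. -/
def col (v : D → K) : R.Col := v

variable {R}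

@[ext] lemma Col.ext {v w : R.Col} (h : ∀ p, v p = w p) : v = w := funext h

@[simp] lemma col_apply (v : D → K) (p : D) : R.col v p = v p := rfl
@[simp] lemma add_apply (v w : R.Col) (p : D) : (v + w) p = v p + w p := rfl
@[simp] lemma sub_apply (v w : R.Col) (p : D) : (v - w) p = v p - w p := rfl
@[simp] lemma zero_apply (p : D) : (0 : R.Col) p = 0 := rfl
@[simp] lemma scalar_smul_apply (k : K) (v : R.Col) (p : D) : (k • v) p = k * v p := rfl

lemma smul_apply (a : A) (v : R.Col) (p : D) : (a • v) p = ∑ q, R.toMatrix a p q * v q := rfl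

instance : IsScalarTower K A R.Col := ⟨fun k a (v : D → K) => by
  funext p
  change (R.toMatrix (k • a)).mulVec v p = k • (R.toMatrix a).mulVec v p
  rw [map_smul, Matrix.smul_mulVec]
  rfl⟩

lemma unit_smul {p q : D} (h : p < q) (v : R.Col) :
    R.unit p q • v = R.col (Pi.single p (v q)) := by
  ext r
  simp only [smul_apply, toMatrix_unit_apply, h, true_and, col_apply]
  rw [Finset.sum_eq_single q]
  · by_cases hr : p = r
    · subst hr; simp
    · simp [hr]
  · intro s _ hs
    simp [Ne.symm hs]
  · simp

lemma idem_smul_apply (p r : D) (v : R.Col) :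
    (R.idem p • v) r = if r = p ∨ r = F.swap p then v r else 0 := by
  rw [smul_apply, toMatrix_idem, edgeMatrix, Finset.sum_eq_single r]
  · simp
  · intro q _ hq
    rw [Matrix.diagonal_apply_ne _ (Ne.symm hq), zero_mul]
  · simp

variable (R)

/-- The submodule of the column vectors that vanish on `U`. -/
def vanish (U : UpperSet D) : Submodule A R.Col where
  carrier := {v | ∀ q ∈ U, v q = 0}
  add_mem' hv hw q hq := by rw [add_apply, hv q hq, hw q hq, add_zero]
  zero_mem' q _ := rfl
  smul_mem' a v hv q hq := by
    rw [smul_apply]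
    refine Finset.sum_eq_zero fun r _ => ?_
    by_cases h : q ≤ r
    · rw [hv r (U.upper h hq), mul_zero]
    · rw [R.eq_zero_of_not_le a h, zero_mul]

lemma mem_vanish {U : UpperSet D} {v : R.Col} : v ∈ R.vanish U ↔ ∀ q ∈ U, v q = 0 := Iff.rfl

/-- The module of the vectors with entries indexed by the elements of `U`. -/
abbrev Quot (U : UpperSet D) : Type u := R.Col ⧸ R.vanish U

lemma mk_eq_mk_iff {U : UpperSet D} {v w : R.Col} :
    (R.vanish U).mkQ v = (R.vanish U).mkQ w ↔ ∀ q ∈ U, v q = w q := by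
  rw [Submodule.mkQ_apply, Submodule.mkQ_apply, Submodule.Quotient.eq, mem_vanish]
  exact forall₂_congr fun q _ => sub_eq_zero

/-! ### The injective modules of the edges -/

/-- The functional on the column vectors that adds up the two entries at the edge of `p`. -/
def edgeSum (p : D) : R.Col →ₗ[K] K where
  toFun v := v p + v (F.swap p)
  map_add' v w := by simp only [add_apply]; ring
  map_smul' k v := by simp [mul_add]

/-- The homomorphism from the column vectors to the coinduced module given by `R.edgeSum p`. -/
def edgeHom (p : D) : R.Col →ₗ[A] DualModule K A := DualModule.homOfFunctional (R.edgeSum p)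

lemma edgeHom_apply (p : D) (v : R.Col) (a : A) :
    R.edgeHom p v a = (a • v) p + (a • v) (F.swap p) := rfl

/-- The injective module of the edge of `p`, the dual of the right module generated by `R.idem p`.
It is glued from the modules of the vectors on the darts above `p` and above `F.swap p` along
their socles. -/
abbrev Envelope (p : D) : Type u := R.Col ⧸ LinearMap.ker (R.edgeHom p)

lemma mem_ker_edgeHom {p : D} {v : R.Col} :
    v ∈ LinearMap.ker (R.edgeHom p) ↔
      (∀ q, p < q ∨ F.swap p < q → v q = 0) ∧ v p + v (F.swap p) = 0 := by
  rw [LinearMap.mem_ker]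
  constructor
  · intro h
    have h' (a : A) : (a • v) p + (a • v) (F.swap p) = 0 := congrArg (fun f => f a) h
    refine ⟨fun q hq => ?_, by simpa using h' 1⟩
    rcases hq with hq | hq
    · simpa [unit_smul hq, F.swap_ne] using h' (R.unit p q)
    · simpa [unit_smul hq, (F.swap_ne p).symm] using h' (R.unit (F.swap p) q)
  · rintro ⟨h, h'⟩
    ext a
    have aux (r : D) (hr : ∀ q, r < q → v q = 0) : (a • v) r = R.toMatrix a r r * v r := by
      rw [smul_apply]
      refine Finset.sum_eq_single r (fun q _ hq => ?_) (by simp)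
      by_cases hrq : r ≤ q
      · rw [hr q (lt_of_le_of_ne hrq (Ne.symm hq)), mul_zero]
      · rw [R.eq_zero_of_not_le a hrq, zero_mul]
    rw [edgeHom_apply, aux p fun q hq => h q (Or.inl hq),
      aux _ fun q hq => h q (Or.inr hq), R.apply_swap, ← mul_add, h', mul_zero]
    rfl

/-- The expansion of an element in the right module generated by `R.idem p`. -/
lemma idem_mul_eq_sum (p : D) (b : A) : R.idem p * b = R.toMatrix b p p • R.idem p +
    ∑ q, (R.toMatrix b p q • R.unit p q + R.toMatrix b (F.swap p) q • R.unit (F.swap p) q) := by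
  refine R.injective ?_
  ext r s
  have hl : R.toMatrix (R.idem p * b) r s =
      if r = p ∨ r = F.swap p then R.toMatrix b r s else 0 := by
    rw [map_mul, toMatrix_idem, edgeMatrix, Matrix.diagonal_mul]
    split_ifs <;> simp
  have hr (t : D) : ∑ q, R.toMatrix b t q * R.toMatrix (R.unit t q) r s =
      if t = r ∧ r < s then R.toMatrix b r s else 0 := by
    simp only [toMatrix_unit_apply]
    rw [Finset.sum_eq_single s]
    · by_cases h : t = r
      · subst h; simp
      · simp [h]
    · intro q _ hq
      simp [hq]
    · simp
  rw [hl]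
  simp only [map_add, map_smul, map_sum, Matrix.add_apply, Matrix.smul_apply, Matrix.sum_apply,
    smul_eq_mul, Finset.sum_add_distrib, hr, toMatrix_idem, edgeMatrix]
  have hne := F.swap_ne p
  by_cases hrs : r = s
  · subst hrs
    by_cases h₁ : r = p
    · simp [h₁]
    · by_cases h₂ : r = F.swap p
      · subst h₂
        simp [R.apply_swap]
      · simp [h₁, h₂]
  · rw [Matrix.diagonal_apply_ne _ hrs, mul_zero, zero_add]
    have h₀ : ¬ r < s → R.toMatrix b r s = 0 := fun h =>
      R.eq_zero_of_not_le b fun h' => h (lt_of_le_of_ne h' hrs)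
    by_cases h₁ : r = p
    · subst h₁
      by_cases h : r < s
      · simp [h, hne]
      · simp [h, h₀ h]
    · by_cases h₂ : r = F.swap p
      · subst h₂
        by_cases h : F.swap p < s
        · simp [h, hne.symm]
        · simp [h, h₀ h]
      · simp [h₁, h₂, Ne.symm h₁, Ne.symm h₂]

lemma exists_edgeHom_eq (p : D) (f : DualModule K A) :
    ∃ v : R.Col, ∀ b, R.edgeHom p v b = f (R.idem p * b) := by
  refine ⟨R.col fun q => f (R.unit p q) + f (R.unit (F.swap p) q) +
    if q = p then f (R.idem p) else 0, fun b => ?_⟩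
  have h₁ (q : D) : R.toMatrix b p q * f (R.unit (F.swap p) q) = 0 := by
    by_cases h : F.swap p < q
    · rw [R.eq_zero_of_not_le b (F.not_le_of_swap_le h.le), zero_mul]
    · have : R.unit (F.swap p) q = 0 := R.injective (by rw [toMatrix_unit, if_neg h, map_zero])
      rw [this, map_zero, mul_zero]
  have h₂ (q : D) : R.toMatrix b (F.swap p) q * f (R.unit p q) = 0 := by
    by_cases h : p < q
    · rw [R.eq_zero_of_not_le b fun h' => F.not_le_of_swap_le h' h.le, zero_mul]
    · have : R.unit p q = 0 := R.injective (by rw [toMatrix_unit, if_neg h, map_zero])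
      rw [this, map_zero, mul_zero]
  have h₃ : R.toMatrix b (F.swap p) p = 0 :=
    R.eq_zero_of_not_le b fun h => F.not_comparable_swap p (Or.inr h)
  rw [idem_mul_eq_sum, edgeHom_apply, smul_apply, smul_apply]
  simp [mul_add, Finset.sum_add_distrib, h₁, h₂, h₃]
  ring

instance injective_envelope (p : D) : Module.Injective A (R.Envelope p) := by
  rw [← injDimLT_one_iff]
  -- `f ↦ (b ↦ f (R.idem p * b))` projects the coinduced module onto the image of `R.edgeHom p`
  let θ := R.edgeHom p
  let e : DualModule K A →ₗ[A] DualModule K A :=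
    { toFun := fun f => LinearMap.comp (show A →ₗ[K] K from f) (LinearMap.mulLeft K (R.idem p))
      map_add' := fun f g => rfl
      map_smul' := fun a f => DualModule.ext fun b => congrArg f (mul_assoc _ b a) }
  have he (f : DualModule K A) : e f ∈ LinearMap.range θ := by
    obtain ⟨v, hv⟩ := R.exists_edgeHom_eq p f
    exact ⟨v, DualModule.ext hv⟩
  have hfix (v : R.Col) : e (θ v) = θ v := by
    ext b
    change R.edgeHom p v (R.idem p * b) = R.edgeHom p v b
    rw [edgeHom_apply, edgeHom_apply, mul_smul, idem_smul_apply, idem_smul_apply]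
    simp
  refine InjDimLT.of_retract (N := DualModule K A) (injDimLT_one_iff.2 inferInstance)
    ((LinearMap.range θ).subtype ∘ₗ θ.quotKerEquivRange.toLinearMap)
    (θ.quotKerEquivRange.symm.toLinearMap ∘ₗ e.codRestrict _ he) fun x => ?_
  obtain ⟨v, rfl⟩ := Submodule.mkQ_surjective _ x
  rw [LinearMap.comp_apply, LinearEquiv.coe_coe, LinearEquiv.symm_apply_eq]
  exact Subtype.ext (hfix v)

/-! ### The cosyzygies of the fans -/

/-- The column vector that agrees with `v` above `p` and vanishes elsewhere. -/
def restrict (p : D) (v : R.Col) : R.Col := R.col fun q => if p ≤ q then v q else 0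

lemma restrict_apply_of_le {p q : D} (h : p ≤ q) (v : R.Col) : R.restrict p v q = v q := if_pos h

lemma restrict_apply_of_not_le {p q : D} (h : ¬ p ≤ q) (v : R.Col) : R.restrict p v q = 0 :=
  if_neg h

lemma restrict_apply_of_swap_le {p q : D} (h : F.swap p ≤ q) (v : R.Col) :
    R.restrict p v q = 0 := if_neg (F.not_le_of_swap_le h)

/-- The inclusion of the module of the darts above `p` in the injective module of the edge of
`p`. -/
def toEnvelope (p : D) : R.Quot (UpperSet.Ici p) →ₗ[A] R.Envelope p :=
  Submodule.liftQ _
    { toFun := fun v => Submodule.mkQ _ (R.restrict p v)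
      map_add' := fun v w => by
        rw [← map_add]
        congr 1
        ext q
        by_cases h : p ≤ q <;> simp [restrict, h]
      map_smul' := fun a v => by
        rw [RingHom.id_apply, ← map_smul, Submodule.mkQ_apply, Submodule.mkQ_apply,
          Submodule.Quotient.eq, mem_ker_edgeHom]
        have h₁ (q : D) (hq : p ≤ q) : (R.restrict p (a • v) - a • R.restrict p v) q = 0 := by
          rw [sub_apply, restrict_apply_of_le R hq, smul_apply, smul_apply, sub_eq_zero]
          refine Finset.sum_congr rfl fun r _ => ?_
          by_cases h : q ≤ r
          · rw [restrict_apply_of_le R (hq.trans h)]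
          · rw [R.eq_zero_of_not_le a h, zero_mul, zero_mul]
        have h₂ (q : D) (hq : F.swap p ≤ q) :
            (R.restrict p (a • v) - a • R.restrict p v) q = 0 := by
          rw [sub_apply, restrict_apply_of_swap_le R hq, smul_apply, zero_sub, neg_eq_zero]
          refine Finset.sum_eq_zero fun r _ => ?_
          by_cases h : q ≤ r
          · rw [restrict_apply_of_swap_le R (hq.trans h), mul_zero]
          · rw [R.eq_zero_of_not_le a h, zero_mul]
        refine ⟨fun q hq => hq.elim (fun h => h₁ q h.le) fun h => h₂ q h.le, ?_⟩
        rw [h₁ p le_rfl, h₂ _ le_rfl, add_zero] }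
    fun v hv => by
      rw [LinearMap.mem_ker]
      refine (Submodule.Quotient.mk_eq_zero _).2 ?_
      have : R.restrict p v = 0 := by
        ext q
        by_cases h : p ≤ q
        · exact (R.restrict_apply_of_le h v).trans (hv q h)
        · exact R.restrict_apply_of_not_le h v
      rw [this]
      exact zero_mem _

lemma toEnvelope_mk (p : D) (v : R.Col) : R.toEnvelope p (Submodule.mkQ _ v) =
    Submodule.mkQ _ (R.restrict p v) := rfl

/-- The projection of the injective module of the edge of `p` onto the module of the darts strictly
above `F.swap p`. -/
def ofEnvelope (p : D) : R.Envelope p →ₗ[A] R.Quot (UpperSet.Ioi (F.swap p)) :=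
  Submodule.liftQ _ (Submodule.mkQ _) fun v hv => by
    rw [LinearMap.mem_ker]
    refine (Submodule.Quotient.mk_eq_zero _).2 fun q hq => ?_
    exact (R.mem_ker_edgeHom.1 hv).1 q (Or.inr hq)

lemma ofEnvelope_mk (p : D) (v : R.Col) : R.ofEnvelope p (Submodule.mkQ _ v) =
    Submodule.mkQ _ v := rfl

lemma ofEnvelope_surjective (p : D) : Function.Surjective (R.ofEnvelope p) := fun x => by
  obtain ⟨v, rfl⟩ := Submodule.mkQ_surjective _ x
  exact ⟨_, R.ofEnvelope_mk p v⟩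

lemma toEnvelope_injective (p : D) : Function.Injective (R.toEnvelope p) := by
  rw [injective_iff_map_eq_zero]
  intro x hx
  obtain ⟨v, rfl⟩ := Submodule.mkQ_surjective _ x
  rw [toEnvelope_mk, Submodule.mkQ_apply, Submodule.Quotient.mk_eq_zero, mem_ker_edgeHom] at hx
  refine (Submodule.Quotient.mk_eq_zero _).2 fun q hq => ?_
  rcases (UpperSet.mem_Ici_iff.1 hq).lt_or_eq with h | rfl
  · rw [← R.restrict_apply_of_le h.le v, hx.1 q (Or.inl h)]
  · rw [← hx.2, restrict_apply_of_le R le_rfl, restrict_apply_of_swap_le R le_rfl, add_zero]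

lemma exact_toEnvelope_ofEnvelope (p : D) :
    Function.Exact (R.toEnvelope p) (R.ofEnvelope p) := by
  intro x
  constructor
  · intro hx
    obtain ⟨v, rfl⟩ := Submodule.mkQ_surjective _ x
    rw [ofEnvelope_mk, Submodule.mkQ_apply, Submodule.Quotient.mk_eq_zero, mem_vanish] at hx
    refine ⟨Submodule.mkQ _ (v + R.col (Pi.single p (v (F.swap p)))), ?_⟩
    rw [toEnvelope_mk, Submodule.mkQ_apply, Submodule.mkQ_apply, Submodule.Quotient.eq,
      mem_ker_edgeHom]
    constructor
    · rintro q (hq | hq)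
      · simp [restrict_apply_of_le R hq.le, hq.ne']
      · simp [restrict_apply_of_swap_le R hq.le, hx q hq]
    · simp [restrict_apply_of_le R le_rfl, restrict_apply_of_swap_le R le_rfl]
  · rintro ⟨y, rfl⟩
    obtain ⟨v, rfl⟩ := Submodule.mkQ_surjective _ y
    rw [toEnvelope_mk, ofEnvelope_mk, Submodule.mkQ_apply, Submodule.Quotient.mk_eq_zero]
    exact fun q hq => R.restrict_apply_of_swap_le (le_of_lt hq) v

lemma mkQ_single_ne_zero (p : D) :
    (R.vanish (UpperSet.Ici p)).mkQ (R.col (Pi.single p 1)) ≠ 0 := fun h => by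
  rw [Submodule.mkQ_apply, Submodule.Quotient.mk_eq_zero] at h
  have := h p (UpperSet.mem_Ici_iff.2 le_rfl)
  simp at this

/-- If there is a dart above `F.swap p`, then the module of the darts above `p` is a proper
essential submodule of its envelope. -/
lemma not_injDimLT_one {p q : D} (h : F.swap p < q) :
    ¬ InjDimLT A (R.Quot (UpperSet.Ici p)) 1 := by
  intro hinj
  obtain ⟨ρ, hρ⟩ := (injDimLT_one_iff.1 hinj).out (R.toEnvelope p) (R.toEnvelope_injective p)
    LinearMap.id
  refine R.mkQ_single_ne_zero p ?_
  -- `R.unit (F.swap p) q` maps onto the socle of the envelope, but acts as zero on the submodule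
  have h₁ : R.toEnvelope p ((R.vanish (UpperSet.Ici p)).mkQ (R.col (Pi.single p 1))) =
      R.unit (F.swap p) q • Submodule.mkQ _ (R.col (Pi.single q 1)) := by
    rw [toEnvelope_mk, ← map_smul, unit_smul h, Submodule.mkQ_apply, Submodule.mkQ_apply,
      Submodule.Quotient.eq, mem_ker_edgeHom]
    constructor
    · rintro r (hr | hr)
      · have : r ≠ F.swap p := by
          rintro rfl
          exact F.not_le_of_swap_le le_rfl hr.le
        simp [restrict_apply_of_le R hr.le, hr.ne', this]
      · simp [restrict_apply_of_swap_le R hr.le, hr.ne']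
    · simp [restrict_apply_of_le R le_rfl, restrict_apply_of_swap_le R le_rfl, (F.swap_ne p).symm]
  rw [← LinearMap.id_apply (R := A) ((R.vanish (UpperSet.Ici p)).mkQ _), ← hρ, h₁, map_smul]
  obtain ⟨w, hw⟩ := Submodule.mkQ_surjective _ (ρ (Submodule.mkQ _ (R.col (Pi.single q 1))))
  rw [← hw, ← map_smul, unit_smul h, Submodule.mkQ_apply, Submodule.Quotient.mk_eq_zero]
  refine fun r hr => Pi.single_eq_of_ne ?_ _
  rintro rfl
  exact F.not_le_of_swap_le le_rfl (UpperSet.mem_Ici_iff.1 hr)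

/-- If the chain that starts at `p` has length `l`, then the module of the darts above `p` has
injective dimension `l - 1`: each step of the chain is a cosyzygy. -/
lemma injDimLT_of_chain {p : D} {l : ℕ} (h : F.Chain p l) :
    InjDimLT A (R.Quot (UpperSet.Ici p)) l ∧ ¬ InjDimLT A (R.Quot (UpperSet.Ici p)) (l - 1) := by
  have henv (p : D) : InjDimLT A (R.Envelope p) 1 := injDimLT_one_iff.2 inferInstance
  induction h with
  | one p hp =>
    constructor
    · refine injDimLT_left (n := 0) _ _ (R.toEnvelope_injective p) (R.ofEnvelope_surjective p)
        (R.exact_toEnvelope_ofEnvelope p) (henv p) (injDimLT_zero_iff.2 ?_)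
      refine subsingleton_of_forall_eq 0 fun x => ?_
      obtain ⟨v, rfl⟩ := Submodule.mkQ_surjective _ x
      exact (Submodule.Quotient.mk_eq_zero _).2 fun q hq => absurd hq (hp q)
    · rw [Nat.sub_self, injDimLT_zero_iff]
      exact fun hs => R.mkQ_single_ne_zero p (Subsingleton.elim _ _)
  | succ p q l hpq h ih =>
    rw [← F.Ioi_eq_Ici hpq] at ih
    obtain ⟨l, rfl⟩ : ∃ m, l = m + 1 := ⟨l - 1, by have := h.pos; omega⟩
    refine ⟨injDimLT_left _ _ (R.toEnvelope_injective p) (R.ofEnvelope_surjective p)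
      (R.exact_toEnvelope_ofEnvelope p) ((henv p).mono (by omega)) ih.1, fun h' => ?_⟩
    rw [Nat.add_sub_cancel] at h' ih
    cases l with
    | zero => exact R.not_injDimLT_one hpq.lt h'
    | succ l =>
      exact ih.2 (injDimLT_right _ _ (R.toEnvelope_injective p) (R.ofEnvelope_surjective p)
        (R.exact_toEnvelope_ofEnvelope p) h' ((henv p).mono (by omega)))

end Realization
end FanSystem

namespace FanSystem

lemma exists_minimal_le {D : Type} [PartialOrder D] [Finite D] (q : D) :
    ∃ p ≤ q, ∀ r : D, ¬ r < p := by
  obtain ⟨p, hp, hmin⟩ := Finite.exists_le_minimal (p := fun _ : D => True) (a := q) trivial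
  exact ⟨p, hp, fun r hr => hmin.not_lt trivial hr⟩

namespace Realization

open scoped Classical

variable {D : Type} [PartialOrder D] {F : FanSystem D} [Fintype D] [DecidableEq D]
  {K A : Type u} [Field K] [Ring A] [Algebra K A] (R : F.Realization K A)

/-! ### The regular module -/

/-- The embedding of the algebra in the product of the modules of the fans, which sends an element
to the columns of its matrix. -/
def columns : A →ₗ[A] ∀ q : D, R.Quot (F.fan q) :=
  LinearMap.pi fun q => Submodule.mkQ _ ∘ₗ
    { toFun := fun a => R.col fun p => R.toMatrix a p q
      map_add' := fun a b => by ext; simp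
      map_smul' := fun a b => by
        ext
        simp [smul_apply, Matrix.mul_apply] }

lemma columns_apply (a : A) (q : D) :
    R.columns a q = Submodule.mkQ _ (R.col fun p => R.toMatrix a p q) := rfl

lemma columns_injective : Function.Injective R.columns := fun a b h => by
  refine R.injective ?_
  ext p q
  by_cases hpq : p ≤ q
  · have := congrFun h q
    rw [columns_apply, columns_apply, mk_eq_mk_iff] at this
    exact this p (Or.inl hpq)
  · rw [R.eq_zero_of_not_le a hpq, R.eq_zero_of_not_le b hpq]

/-- The homomorphism from the module of a fan to the coinduced module that is given by the entry at
`q`. -/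
def entryHom (q : D) : R.Quot (F.fan q) →ₗ[A] DualModule K A :=
  Submodule.liftQ _ (DualModule.homOfFunctional
    { toFun := fun v => v q
      map_add' := fun v w => rfl
      map_smul' := fun k v => rfl }) fun v hv => by
    rw [LinearMap.mem_ker]
    ext a
    exact (R.vanish (F.fan q)).smul_mem a hv q (Or.inl le_rfl)

/-- The alternating trace: the sum of the entries at the darts on the diagonal, with signs that are
opposite at the two darts of an edge. Its kernel is the image of `R.columns`. -/
def alternatingTrace : (∀ q : D, R.Quot (F.fan q)) →ₗ[A] DualModule K A :=
  ∑ q, (F.sign q : ℤ) • (R.entryHom q ∘ₗ LinearMap.proj q)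

lemma alternatingTrace_mk (v : D → R.Col) (a : A) :
    R.alternatingTrace (fun q => Submodule.mkQ _ (v q)) a =
      ∑ q, (F.sign q : ℤ) • (a • v q) q := by
  let ev : DualModule K A →+ K :=
    { toFun := fun f => f a, map_zero' := rfl, map_add' := fun _ _ => rfl }
  change ev _ = _
  rw [alternatingTrace, LinearMap.sum_apply, map_sum]
  refine Finset.sum_congr rfl fun q _ => ?_
  rw [LinearMap.smul_apply, map_zsmul]
  rfl

lemma alternatingTrace_surjective : Function.Surjective R.alternatingTrace := fun f => by
  refine ⟨fun q => Submodule.mkQ _ (R.col fun r => (F.sign q : ℤ) • f (R.unit q r) +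
    if r = q ∧ F.sign q = 1 then f (R.idem q) else 0), ?_⟩
  ext b
  rw [alternatingTrace_mk]
  conv_rhs => rw [R.eq_sum b, map_sum]
  refine Finset.sum_congr rfl fun q _ => ?_
  rw [smul_apply, map_add, map_sum]
  simp only [col_apply, mul_add, Finset.sum_add_distrib, smul_add]
  congr 1
  · rw [Finset.smul_sum]
    refine Finset.sum_congr rfl fun r _ => ?_
    rw [mul_smul_comm, smul_smul, ← Units.val_mul, Int.units_mul_self, Units.val_one, one_smul,
      map_smul, smul_eq_mul]
  · rw [Finset.sum_eq_single q]
    · by_cases h : F.sign q = 1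
      · simp [h]
      · simp [h]
    · intro r _ hr
      simp [hr]
    · simp

lemma exact_columns_alternatingTrace : Function.Exact R.columns R.alternatingTrace := by
  intro x
  choose v hv using fun q => Submodule.mkQ_surjective (R.vanish (F.fan q)) (x q)
  obtain rfl : (fun q => Submodule.mkQ _ (v q)) = x := funext hv
  constructor
  · intro h
    have h' (a : A) : ∑ q, (F.sign q : ℤ) • (a • v q) q = 0 := by
      rw [← alternatingTrace_mk, h]
      rfl
    have hdiag (p : D) : v (F.swap p) (F.swap p) = v p p := by
      have := h' (R.idem p)
      simp only [idem_smul_apply] at this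
      rw [← Finset.sum_subset (Finset.subset_univ {p, F.swap p}),
        Finset.sum_pair (F.swap_ne p).symm] at this
      · simp only [true_or, or_true, if_true, F.sign_swap, Units.val_neg, neg_smul] at this
        rw [← sub_eq_add_neg, ← smul_sub] at this
        obtain hs | hs := Int.units_eq_one_or (F.sign p)
        · rw [hs, Units.val_one, one_smul, sub_eq_zero] at this
          exact this.symm
        · rw [hs, Units.val_neg, Units.val_one, neg_one_smul, neg_eq_zero, sub_eq_zero] at this
          exact this.symm
      · intro q _ hq
        rw [Finset.mem_insert, Finset.mem_singleton] at hq
        rw [if_neg hq, smul_zero]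
    have hlower (p q : D) (hpq : p < q) : v p q = 0 := by
      have := h' (R.unit p q)
      simp only [unit_smul hpq, col_apply] at this
      rw [Finset.sum_eq_single p] at this
      · obtain hs | hs := Int.units_eq_one_or (F.sign p) <;> simpa [hs] using this
      · intro r _ hr
        rw [Pi.single_eq_of_ne hr, smul_zero]
      · simp
    obtain ⟨a, ha⟩ := R.exists_eq (Matrix.of fun p q => if p ≤ q then v q p else 0)
      (fun p q hpq => by
        by_contra hle
        exact hpq (if_neg hle)) fun p => by simpa using hdiag p
    refine ⟨a, funext fun q => ?_⟩
    rw [columns_apply, mk_eq_mk_iff]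
    intro p hp
    rw [col_apply, ha, Matrix.of_apply]
    by_cases hpq : p ≤ q
    · rw [if_pos hpq]
    · rw [if_neg hpq, hlower q p (lt_of_le_not_ge (hp.resolve_left hpq) hpq)]
  · rintro ⟨a, ha⟩
    rw [← ha]
    ext b
    change R.alternatingTrace (fun q => Submodule.mkQ _ (R.col fun p => R.toMatrix a p q)) b = 0
    rw [alternatingTrace_mk]
    have h (q : D) : (b • R.col fun p => R.toMatrix a p q) q = R.toMatrix (b * a) q q := by
      rw [smul_apply, map_mul, Matrix.mul_apply]
      rfl
    simp only [h]
    refine Finset.sum_involution (fun q _ => F.swap q) (fun q _ => ?_) (fun q _ _ => F.swap_ne q)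
      (fun q _ => Finset.mem_univ _) fun q _ => F.swap_swap q
    rw [R.apply_swap, F.sign_swap, Units.val_neg, neg_smul, add_neg_cancel]

include R in
/-- The injective dimension of the algebra is determined by the longest chain that starts at the
bottom of a fan, provided that it consists of at least two darts. -/
theorem injectiveDimension_eq {k : ℕ} (hk : 2 ≤ k)
    (hle : ∀ p : D, (∀ r, ¬ r < p) → ∃ l ≤ k, F.Chain p l)
    (hex : ∃ p : D, (∀ r, ¬ r < p) ∧ F.Chain p k) :
    injectiveDimension (ModuleCat.of A A) = ((k - 1 : ℕ) : WithBot ℕ∞) := by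
  obtain ⟨k, rfl⟩ : ∃ m, k = m + 2 := ⟨k - 2, by omega⟩
  have hdual : InjDimLT A (DualModule K A) 1 := injDimLT_one_iff.2 inferInstance
  refine injectiveDimension_eq_of_injDimLT ?_ fun h => ?_
  · refine injDimLT_left (n := k + 1) _ _ R.columns_injective R.alternatingTrace_surjective
      R.exact_columns_alternatingTrace ?_ (hdual.mono (by omega))
    refine injDimLT_pi _ _ fun q => ?_
    obtain ⟨p, hpq, hp⟩ := exists_minimal_le q
    obtain ⟨l, hl, hc⟩ := hle p hp
    rw [F.fan_eq_Ici hp hpq]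
    exact (R.injDimLT_of_chain hc).1.mono hl
  · obtain ⟨p, hp, hc⟩ := hex
    have h' : InjDimLT A (∀ q : D, R.Quot (F.fan q)) (k + 1) :=
      injDimLT_middle _ _ R.columns_injective R.alternatingTrace_surjective
        R.exact_columns_alternatingTrace h (hdual.mono (by omega))
    have h'' : InjDimLT A (R.Quot (F.fan p)) (k + 1) :=
      h'.of_retract (LinearMap.single A (fun q => R.Quot (F.fan q)) p) (LinearMap.proj p)
        fun x => by simp
    rw [F.fan_eq_Ici hp le_rfl] at h''
    exact (R.injDimLT_of_chain hc).2 h''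

end Realization

/-! ### Reversal of chains -/

section Reverse

variable {D : Type} [PartialOrder D] (F : FanSystem D)

/-- A chain, followed backwards from its end, extends any chain of the reversed fan system that
starts where it ends. -/
lemma Chain.exists_reverse {p : D} {l : ℕ} (h : F.Chain p l) :
    ∃ q : D, (∀ r, ¬ q < r) ∧ ∀ m, F.reverse.Chain (OrderDual.toDual (F.swap p)) m →
      F.reverse.Chain (OrderDual.toDual q) (m + l - 1) := by
  induction h with
  | one p hp => exact ⟨F.swap p, hp, fun m hm => hm⟩
  | succ p q l hq h ih =>
    obtain ⟨s, hs, hs'⟩ := ih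
    refine ⟨s, hs, fun m hm => ?_⟩
    have h₁ : F.reverse.Chain (OrderDual.toDual (F.swap q)) (m + 1) := by
      refine Chain.succ _ (OrderDual.toDual (F.swap p)) m ?_ hm
      change OrderDual.toDual (F.swap (F.swap q)) ⋖ _
      rw [F.swap_swap]
      exact hq.toDual
    have := hs' _ h₁
    rwa [show m + 1 + l - 1 = m + (l + 1) - 1 by omega] at this

/-- A chain that starts at the bottom of a fan has a reversed chain of the same length. -/
lemma Chain.reverse {p : D} {l : ℕ} (h : F.Chain p l) (hp : ∀ r, ¬ r < p) :
    ∃ q : D, (∀ r, ¬ q < r) ∧ F.reverse.Chain (OrderDual.toDual q) l := by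
  obtain ⟨q, hq, h'⟩ := h.exists_reverse
  refine ⟨q, hq, ?_⟩
  have := h' 1 <| Chain.one _ fun r hr => by
    refine hp r.ofDual ?_
    have hr' : r.ofDual < F.swap (F.swap p) := hr
    rwa [F.swap_swap] at hr'
  rwa [show 1 + l - 1 = l by omega] at this

lemma exists_covBy_of_lt [Finite D] {p q : D} (h : p < q) : ∃ r, p ⋖ r := by
  obtain ⟨r, -, hr⟩ := Finite.exists_le_minimal (p := fun r : D => p < r) h
  exact ⟨r, hr.prop, fun s hps hsr => hr.not_lt hps hsr⟩

/-- The sequence of darts that starts at the bottom of a fan cannot return, and so it stops. -/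
lemma exists_chain [Finite D] {p : D} (hp : ∀ r, ¬ r < p) : ∃ l, F.Chain p l := by
  by_contra! hno
  have hstep (q : D) (hq : ∀ l, ¬ F.Chain q l) : ∃ r, F.swap q ⋖ r ∧ ∀ l, ¬ F.Chain r l := by
    by_cases h : ∃ r, F.swap q < r
    · obtain ⟨r, hr⟩ := h
      obtain ⟨s, hs⟩ := exists_covBy_of_lt hr
      exact ⟨s, hs, fun l hl => hq _ (Chain.succ q s l hs hl)⟩
    · exact absurd (Chain.one q fun r hr => h ⟨r, hr⟩) (hq 1)
  choose! next hnext hnext' using hstep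
  let f : ℕ → D := fun n => next^[n] p
  have hf (n : ℕ) : ∀ l, ¬ F.Chain (f n) l := by
    induction n with
    | zero => exact hno
    | succ n ih =>
      simp only [f, Function.iterate_succ_apply']
      exact hnext' _ ih
  have hcov (n : ℕ) : F.swap (f n) ⋖ f (n + 1) := by
    simp only [f, Function.iterate_succ_apply']
    exact hnext _ (hf n)
  refine not_injective_infinite_finite f fun m n hmn => ?_
  have hback (m n : ℕ) (h : f (m + 1) = f (n + 1)) : f m = f n := by
    refine F.swap_injective ?_
    have h₁ := hcov m
    have h₂ := hcov n
    rw [← h] at h₂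
    rcases F.comparable_trans _ _ _ (Or.inl h₁.le) (Or.inr h₂.le) with h₃ | h₃
    · exact (h₃.lt_or_eq.resolve_left fun h₄ => h₁.2 h₄ h₂.lt)
    · exact (h₃.lt_or_eq.resolve_left fun h₄ => h₂.2 h₄ h₁.lt).symm
  induction m generalizing n with
  | zero =>
    cases n with
    | zero => rfl
    | succ n => exact absurd (hmn ▸ (hcov n).lt : F.swap (f n) < f 0) (hp _)
  | succ m ih =>
    cases n with
    | zero => exact absurd (hmn ▸ (hcov m).lt : F.swap (f m) < f 0) (hp _)
    | succ n => rw [ih n (hback m n hmn)]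

end Reverse

/-- The longest chain that starts at the bottom of a fan also determines the injective dimension of
the right regular module, since chains can be reversed. -/
theorem Realization.hasGorensteinDimension {D : Type} [PartialOrder D] {F : FanSystem D}
    [Fintype D] [DecidableEq D] {K A : Type u} [Field K] [Ring A] [Algebra K A]
    (R : F.Realization K A) {k : ℕ} (hk : 2 ≤ k)
    (hle : ∀ (p : D) (l : ℕ), (∀ r, ¬ r < p) → F.Chain p l → l ≤ k)
    (hex : ∃ p : D, (∀ r, ¬ r < p) ∧ F.Chain p k) :
    HasGorensteinDimension A (k - 1) := by
  constructor
  · refine R.injectiveDimension_eq hk (fun p hp => ?_) hex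
    obtain ⟨l, hl⟩ := F.exists_chain hp
    exact ⟨l, hle p l hp hl, hl⟩
  · have e : Aᵐᵒᵖ ≃ₗ[Aᵐᵒᵖ] A :=
      { MulOpposite.opAddEquiv.symm with map_smul' := fun _ _ => rfl }
    rw [← injectiveDimension_eq_of_iso e.toModuleIso]
    have := R.op.injectiveDimension_eq hk (fun p hp => ?_) ?_
    · exact this
    · obtain ⟨l, hl⟩ := F.reverse.exists_chain hp
      refine ⟨l, ?_, hl⟩
      obtain ⟨q, hq, hq'⟩ := hl.reverse _ hp
      exact hle q l hq hq'
    · obtain ⟨p, hp, hp'⟩ := hex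
      obtain ⟨q, hq, hq'⟩ := hp'.reverse _ hp
      exact ⟨q, hq, hq'⟩

end FanSystem

namespace MarkedDisc

/-! ### The darts of a tiling -/

section Sbtw

variable {n : ℕ}

lemma sbtw_iff_val {a b c : Fin n} : sbtw a b c ↔ (a : ℕ) < b ∧ (b : ℕ) < c ∨
    (b : ℕ) < c ∧ (c : ℕ) < a ∨ (c : ℕ) < a ∧ (a : ℕ) < b := Iff.rfl

lemma eq_or_eq_of_not_sbtw {a b z : Fin n} (hab : a ≠ b) (h : ¬ sbtw b z a) (h' : ¬ sbtw a z b) :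
    z = a ∨ z = b := by
  simp only [sbtw_iff_val, Fin.ext_iff, ne_eq] at *
  omega

lemma separates_point_point {d : Sym2 (Fin n)} {u v : Fin n} :
    Separates d (BoundaryPiece.point u) (BoundaryPiece.point v) ↔
      ∃ a b, d = s(a, b) ∧ sbtw a u b ∧ sbtw b v a := by
  refine exists₂_congr fun a b => and_congr_right fun _ => ?_
  simp only [sbtw_iff_val, BoundaryPiece.pos]
  omega

lemma separates_comm {d : Sym2 (Fin n)} {p q : BoundaryPiece n} :
    Separates d p q ↔ Separates d q p := by
  constructor <;>
  · rintro ⟨a, b, rfl, h, h'⟩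
    exact ⟨b, a, Sym2.eq_swap, h', h⟩

lemma BoundaryPiece.pos_injective : Function.Injective (BoundaryPiece.pos (n := n)) := by
  rintro (i | i) (j | j) h <;> simp only [BoundaryPiece.pos, Fin.mk.injEq] at h
  · rw [Fin.ext (by omega : (i : ℕ) = j)]
  · omega
  · omega
  · rw [Fin.ext (by omega : (i : ℕ) = j)]

instance : Finite (BoundaryPiece n) := Finite.of_injective _ BoundaryPiece.pos_injective

end Sbtw

namespace Tiling

variable {n : ℕ} (T : Tiling n)

lemma not_sbtw_of_sbtw {a b c d : Fin n} (h : s(a, b) ∈ T.diagonals) (h' : s(c, d) ∈ T.diagonals)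
    (hc : sbtw a c b) : ¬ sbtw b d a := fun hd =>
  T.noncrossing _ h _ h' ⟨a, b, c, d, rfl, rfl, hc, hd⟩

lemma exists_isTile_superset {S : Set (BoundaryPiece n)}
    (hS : ∀ p ∈ S, ∀ q ∈ S, ∀ d ∈ T.diagonals, ¬ Separates d p q) : ∃ R, T.IsTile R ∧ S ⊆ R := by
  obtain ⟨R, hSR, hR⟩ := Finite.exists_le_maximal (p := fun S : Set (BoundaryPiece n) =>
    ∀ p ∈ S, ∀ q ∈ S, ∀ d ∈ T.diagonals, ¬ Separates d p q) hS
  exact ⟨R, hR, hSR⟩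

/-- A dart of `T` is a diagonal of `T` together with the choice of one of its endpoints, recorded
as the pair of the chosen endpoint and the other endpoint. -/
def Dart : Type := {p : Fin n × Fin n // s(p.1, p.2) ∈ T.diagonals}

variable {T}

namespace Dart

instance : DecidableEq T.Dart := inferInstanceAs (DecidableEq (Subtype _))
instance : Fintype T.Dart :=
  inferInstanceAs (Fintype {p : Fin n × Fin n // s(p.1, p.2) ∈ T.diagonals})

/-- The marked point at which the dart is based. -/
def base (p : T.Dart) : Fin n := p.1.1

/-- The other endpoint. -/
def tip (p : T.Dart) : Fin n := p.1.2

lemma mem (p : T.Dart) : s(p.base, p.tip) ∈ T.diagonals := p.2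

@[ext] lemma ext {p q : T.Dart} (h : p.base = q.base) (h' : p.tip = q.tip) : p = q :=
  Subtype.ext (Prod.ext h h')

lemma base_ne_tip (p : T.Dart) : p.base ≠ p.tip := fun h =>
  T.endpoints_ne _ p.mem (Sym2.mk_isDiag_iff.2 h)

/-- The dart with the given endpoints. -/
def mk {x a : Fin n} (h : s(x, a) ∈ T.diagonals) : T.Dart := ⟨(x, a), h⟩

@[simp] lemma base_mk {x a : Fin n} (h : s(x, a) ∈ T.diagonals) : (mk h).base = x := rfl
@[simp] lemma tip_mk {x a : Fin n} (h : s(x, a) ∈ T.diagonals) : (mk h).tip = a := rfl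

/-- The other dart of the same diagonal. -/
def swap (p : T.Dart) : T.Dart := mk (Sym2.eq_swap (a := p.base) ▸ p.mem)

@[simp] lemma base_swap (p : T.Dart) : p.swap.base = p.tip := rfl
@[simp] lemma tip_swap (p : T.Dart) : p.swap.tip = p.base := rfl

/-- The darts based at a common marked point are ordered clockwise, starting from the boundary of
the disc. -/
instance : PartialOrder T.Dart where
  le p q := p = q ∨ p.base = q.base ∧ sbtw p.base p.tip q.tip
  lt p q := p.base = q.base ∧ sbtw p.base p.tip q.tip
  le_refl p := Or.inl rfl
  le_trans p q r hpq hqr := by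
    obtain rfl | ⟨h₁, h₂⟩ := hpq
    · exact hqr
    obtain rfl | ⟨h₃, h₄⟩ := hqr
    · exact Or.inr ⟨h₁, h₂⟩
    refine Or.inr ⟨h₁.trans h₃, ?_⟩
    rw [← h₁] at h₄
    simp only [sbtw_iff_val] at h₂ h₄ ⊢
    omega
  le_antisymm p q hpq hqp := by
    obtain rfl | ⟨h₁, h₂⟩ := hpq
    · rfl
    obtain rfl | ⟨h₃, h₄⟩ := hqp
    · rfl
    rw [h₃] at h₄
    simp only [sbtw_iff_val] at h₂ h₄
    omega
  lt_iff_le_not_ge p q := by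
    constructor
    · rintro ⟨h₁, h₂⟩
      refine ⟨Or.inr ⟨h₁, h₂⟩, ?_⟩
      rintro (rfl | ⟨h₃, h₄⟩)
      · exact sbtw_irrefl_right h₂
      · rw [h₃] at h₄
        simp only [sbtw_iff_val] at h₂ h₄
        omega
    · rintro ⟨rfl | h, h'⟩
      · exact absurd (Or.inl rfl) h'
      · exact h

lemma lt_iff {p q : T.Dart} : p < q ↔ p.base = q.base ∧ sbtw p.base p.tip q.tip := Iff.rfl

lemma le_iff {p q : T.Dart} : p ≤ q ↔ p = q ∨ p < q := Iff.rfl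

lemma comparable_iff {p q : T.Dart} : p ≤ q ∨ q ≤ p ↔ p.base = q.base := by
  constructor
  · rintro ((rfl | h) | (rfl | h))
    · rfl
    · exact h.1
    · rfl
    · exact h.1.symm
  · intro h
    by_cases h' : p.tip = q.tip
    · exact Or.inl (Or.inl (ext h h'))
    · have h₁ := p.base_ne_tip
      have h₂ := q.base_ne_tip
      suffices sbtw p.base p.tip q.tip ∨ sbtw p.base q.tip p.tip by
        rw [le_iff, le_iff, lt_iff, lt_iff, ← h]
        tauto
      rw [← h] at h₂
      simp only [ne_eq, Fin.ext_iff] at h' h₁ h₂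
      simp only [sbtw_iff_val]
      omega

/-- The diagonal of a dart. -/
def edge (p : T.Dart) : T.Vertex := ⟨s(p.base, p.tip), p.mem⟩

@[simp] lemma edge_swap (p : T.Dart) : p.swap.edge = p.edge := Subtype.ext Sym2.eq_swap

lemma edge_eq_iff {p q : T.Dart} : p.edge = q.edge ↔ p = q ∨ p = q.swap := by
  constructor
  · intro h
    have h' : s(p.base, p.tip) = s(q.base, q.tip) := congrArg Subtype.val h
    rcases Sym2.eq_iff.1 h' with ⟨h₁, h₂⟩ | ⟨h₁, h₂⟩
    · exact Or.inl (ext h₁ h₂)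
    · exact Or.inr (ext h₁ h₂)
  · rintro (rfl | rfl)
    · rfl
    · rw [edge_swap]

lemma exists_edge_eq (d : T.Vertex) : ∃ p : T.Dart, p.edge = d := by
  obtain ⟨d, hd⟩ := d
  induction d with
  | _ x a => exact ⟨mk hd, rfl⟩

end Dart

variable (T)

/-- The fan system of a tiling: the fans are the sets of darts at the marked points. -/
def fanSystem : FanSystem T.Dart where
  swap := Dart.swap
  swap_swap _ := rfl
  comparable_trans p q r := by
    simp only [Dart.comparable_iff]
    exact Eq.trans
  not_comparable_swap p := by
    rw [Dart.comparable_iff]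
    exact p.base_ne_tip
  sign p := if p.base < p.tip then 1 else -1
  sign_swap p := by
    have := p.base_ne_tip
    rcases lt_or_gt_of_ne this with h | h <;> simp [h, not_lt_of_gt]

@[simp] lemma fanSystem_swap (p : T.Dart) : T.fanSystem.swap p = p.swap := rfl

variable {T}

/-- No diagonal separates the endpoints of two consecutive diagonals at a marked point, so that
these bound a common tile. -/
lemma not_separates_of_covBy {p q : T.Dart} (h : p ⋖ q) :
    ∀ u ∈ ({p.base, p.tip, q.tip} : Set (Fin n)), ∀ v ∈ ({p.base, p.tip, q.tip} : Set (Fin n)),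
      ∀ d ∈ T.diagonals, ¬ Separates d (BoundaryPiece.point u) (BoundaryPiece.point v) := by
  have hq : s(p.base, q.tip) ∈ T.diagonals := h.lt.1 ▸ q.mem
  have hlt := h.lt.2
  have key (d) (hd : d ∈ T.diagonals) :
      ¬ Separates d (BoundaryPiece.point p.tip) (BoundaryPiece.point q.tip) := by
    rw [separates_point_point]
    rintro ⟨a, b, rfl, h₁, h₂⟩
    have h₃ := T.not_sbtw_of_sbtw hd (Sym2.eq_swap (a := p.base) ▸ p.mem) h₁
    have h₄ := T.not_sbtw_of_sbtw (Sym2.eq_swap (a := a) ▸ hd) (Sym2.eq_swap (a := p.base) ▸ hq) h₂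
    by_cases h₅ : a = p.base
    · subst h₅
      exact h.2 (c := Dart.mk hd) ⟨rfl, h₁⟩
        ⟨h.lt.1, by simp only [Dart.base_mk, Dart.tip_mk, sbtw_iff_val] at *; omega⟩
    · have h₆ : b = p.base := by
        simp only [Fin.ext_iff, sbtw_iff_val] at *
        omega
      subst h₆
      simp only [sbtw_iff_val] at *
      omega
  have side {x a : Fin n} (hxa : s(x, a) ∈ T.diagonals) (d) (hd : d ∈ T.diagonals) :
      ¬ Separates d (BoundaryPiece.point x) (BoundaryPiece.point a) := by
    rw [separates_point_point]
    rintro ⟨b, c, rfl, h₁, h₂⟩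
    exact T.not_sbtw_of_sbtw hd hxa h₁ h₂
  have refl (x : Fin n) (d : Sym2 (Fin n)) :
      ¬ Separates d (BoundaryPiece.point x) (BoundaryPiece.point x) := by
    rw [separates_point_point]
    rintro ⟨b, c, rfl, h₁, h₂⟩
    simp only [sbtw_iff_val] at *
    omega
  simp only [Set.mem_insert_iff, Set.mem_singleton_iff]
  rintro u (rfl | rfl | rfl) v (rfl | rfl | rfl) d hd
  · exact refl _ d
  · exact side p.mem d hd
  · exact side hq d hd
  · rw [separates_comm]; exact side p.mem d hd
  · exact refl _ d
  · exact key d hd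
  · rw [separates_comm]; exact side hq d hd
  · rw [separates_comm]; exact key d hd
  · exact refl _ d

/-- The arrows of the quiver join consecutive diagonals at a marked point. -/
lemma isArrow_iff {d e : T.Vertex} :
    T.IsArrow d e ↔ ∃ p q : T.Dart, p.edge = d ∧ q.edge = e ∧ p ⋖ q := by
  constructor
  · rintro ⟨⟨R, hR, hd, he⟩, x, a, b, hxa, hxb, hab⟩
    have hdm : s(x, a) ∈ T.diagonals := hxa ▸ d.2
    have hem : s(x, b) ∈ T.diagonals := hxb ▸ e.2
    refine ⟨Dart.mk hdm, Dart.mk hem, Subtype.ext hxa.symm, Subtype.ext hxb.symm, ⟨rfl, hab⟩,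
      fun r hr hr' => ?_⟩
    have ha := hd.2 a (hxa ▸ Sym2.mem_mk_right x a)
    have hb := he.2 b (hxb ▸ Sym2.mem_mk_right x b)
    refine hR.prop _ ha _ hb _ r.mem (separates_point_point.2 ⟨_, _, rfl, ?_, ?_⟩)
    · rw [← hr.1]
      exact hr.2
    · have := hr'.2
      simp only [Dart.tip_mk, sbtw_iff_val] at *
      omega
  · rintro ⟨p, q, rfl, rfl, h⟩
    obtain ⟨R, hR, hSR⟩ := T.exists_isTile_superset
      (S := BoundaryPiece.point '' {p.base, p.tip, q.tip}) (by
        rintro _ ⟨u, hu, rfl⟩ _ ⟨v, hv, rfl⟩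
        exact not_separates_of_covBy h u hu v hv)
    have hmem (u) (hu : u ∈ ({p.base, p.tip, q.tip} : Set (Fin n))) : BoundaryPiece.point u ∈ R :=
      hSR (Set.mem_image_of_mem _ hu)
    refine ⟨⟨R, hR, ⟨p.mem, fun a ha => hmem a ?_⟩, ⟨q.mem, fun a ha => hmem a ?_⟩⟩,
      p.base, p.tip, q.tip, rfl, ?_, h.lt.2⟩
    · rcases Sym2.mem_iff.1 ha with rfl | rfl <;> simp
    · rcases Sym2.mem_iff.1 ha with rfl | rfl <;> simp [← h.lt.1]
    · rw [h.lt.1]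
      rfl

/-- If the diagonals of three darts at a marked point bound a common tile, then the darts are not
distinct, because the middle one separates the others. -/
lemma not_lt_of_bounds {p q r : T.Dart} {R : Set (BoundaryPiece n)} (hR : T.IsTile R)
    (hp : T.Bounds p.edge.1 R) (hr : T.Bounds r.edge.1 R) (hpq : p < q) : ¬ q < r := fun hqr => by
  have ha := hp.2 p.tip (Sym2.mem_mk_right _ _)
  have hb := hr.2 r.tip (Sym2.mem_mk_right _ _)
  refine hR.prop _ ha _ hb _ q.mem (separates_point_point.2 ⟨_, _, rfl, ?_, ?_⟩)
  · rw [← hpq.1]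
    exact hpq.2
  · have := hqr.2
    simp only [sbtw_iff_val] at *
    omega

/-- Two arrows that turn around different endpoints of the diagonal between them come from the same
tile. -/
lemma exists_isTile_of_covBy_swap {p q r : T.Dart} (h : p ⋖ q) (h' : q.swap ⋖ r) :
    ∃ R, T.IsTile R ∧ T.Bounds p.edge.1 R ∧ T.Bounds q.edge.1 R ∧ T.Bounds r.edge.1 R := by
  have H := not_separates_of_covBy h
  have H' := not_separates_of_covBy h'
  simp only [Dart.base_swap, Dart.tip_swap] at H'
  have key (d) (hd : d ∈ T.diagonals) :
      ¬ Separates d (BoundaryPiece.point p.tip) (BoundaryPiece.point r.tip) := by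
    intro hsep
    have h₁ := H p.base (by simp) p.tip (by simp) d hd
    have h₂ := H q.tip (by simp) p.tip (by simp) d hd
    have h₃ := H' q.base (by simp) r.tip (by simp) d hd
    have h₄ := H' q.tip (by simp) r.tip (by simp) d hd
    rw [separates_point_point] at hsep
    obtain ⟨a, b, rfl, h₅, h₆⟩ := hsep
    have aux {u v : Fin n} (hn : ¬ Separates s(a, b) (BoundaryPiece.point u)
        (BoundaryPiece.point v)) : ¬ (sbtw a u b ∧ sbtw b v a) ∧ ¬ (sbtw b u a ∧ sbtw a v b) := by
      rw [separates_point_point] at hn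
      exact ⟨fun h => hn ⟨a, b, rfl, h⟩, fun h => hn ⟨b, a, Sym2.eq_swap, h⟩⟩
    have hx : ¬ sbtw b p.base a := fun hx => (aux h₁).2 ⟨hx, h₅⟩
    have hx' : ¬ sbtw a p.base b := fun hx => (aux h₃).1 ⟨h.lt.1 ▸ hx, h₆⟩
    have hy : ¬ sbtw b q.tip a := fun hy => (aux h₂).2 ⟨hy, h₅⟩
    have hy' : ¬ sbtw a q.tip b := fun hy => (aux h₄).1 ⟨hy, h₆⟩
    have hpq := h.lt.2
    have hqr := h'.lt.2
    rw [Dart.base_swap, Dart.tip_swap, ← h.lt.1] at hqr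
    -- the diagonal `s(a, b)` would have to be that of `q`, which has both other tips on one side
    have hab : a ≠ b := by
      rintro rfl
      exact sbtw_irrefl_left_right h₅
    have hne : p.base ≠ q.tip := h.lt.1 ▸ q.base_ne_tip
    rcases eq_or_eq_of_not_sbtw hab hx hx' with ha | ha <;>
      rcases eq_or_eq_of_not_sbtw hab hy hy' with hb | hb
    · exact hne (ha.trans hb.symm)
    · rw [← ha, ← hb] at h₆
      simp only [sbtw_iff_val] at h₆ hqr
      omega
    · rw [← ha, ← hb] at h₅
      simp only [sbtw_iff_val] at h₅ hpq
      omega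
    · exact hne (ha.trans hb.symm)
  obtain ⟨R, hR, hSR⟩ := T.exists_isTile_superset
    (S := BoundaryPiece.point '' {p.base, p.tip, q.tip, r.tip}) (by
      have hb := h.lt.1
      rintro _ ⟨u, hu, rfl⟩ _ ⟨v, hv, rfl⟩ d hd
      simp only [Set.mem_insert_iff, Set.mem_singleton_iff] at hu hv
      have h₁ : ∀ u v, (u = p.base ∨ u = p.tip ∨ u = q.tip) →
          (v = p.base ∨ v = p.tip ∨ v = q.tip) →
          ¬ Separates d (BoundaryPiece.point u) (BoundaryPiece.point v) := fun u v hu hv =>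
        H u (by simpa using hu) v (by simpa using hv) d hd
      have h₂ : ∀ u v, (u = q.tip ∨ u = q.base ∨ u = r.tip) →
          (v = q.tip ∨ v = q.base ∨ v = r.tip) →
          ¬ Separates d (BoundaryPiece.point u) (BoundaryPiece.point v) := fun u v hu hv =>
        H' u (by simpa using hu) v (by simpa using hv) d hd
      by_cases hu' : u = p.tip
      · by_cases hv' : v = r.tip
        · rw [hu', hv']
          exact key d hd
        · exact h₁ u v (by tauto) (by tauto)
      · by_cases hv' : v = p.tip
        · by_cases hu'' : u = r.tip
          · rw [hu'', hv', separates_comm]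
            exact key d hd
          · exact h₁ u v (by tauto) (by tauto)
        · rw [hb] at hu hv
          exact h₂ u v (by tauto) (by tauto))
  have hmem (u) (hu : u ∈ ({p.base, p.tip, q.tip, r.tip} : Set (Fin n))) :
      BoundaryPiece.point u ∈ R := hSR (Set.mem_image_of_mem _ hu)
  refine ⟨R, hR, ⟨p.mem, fun a ha => hmem a ?_⟩, ⟨q.mem, fun a ha => hmem a ?_⟩,
    ⟨r.mem, fun a ha => hmem a ?_⟩⟩
  · rcases Sym2.mem_iff.1 ha with rfl | rfl <;> simp
  · rcases Sym2.mem_iff.1 ha with rfl | rfl <;> simp [← h.lt.1]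
  · have := h'.lt.1
    rw [Dart.base_swap] at this
    rcases Sym2.mem_iff.1 ha with rfl | rfl <;> simp [← this]

/-! ### The tiling algebra as an algebra of matrices -/

open scoped Classical

variable (K : Type u) [Field K] {n : ℕ} (T : Tiling n)

/-- The matrix of the trivial path at `d`. -/
def vertexMatrix (d : T.Vertex) : Matrix T.Dart T.Dart K :=
  Matrix.diagonal fun p => if p.edge = d then 1 else 0

/-- The matrix of an arrow from `d` to `e`: the matrix unit at the darts of `d` and `e` at the
marked point around which the arrow turns. -/
def arrowMatrix (d e : T.Vertex) : Matrix T.Dart T.Dart K :=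
  Matrix.of fun p q => if p.edge = d ∧ q.edge = e ∧ p < q then 1 else 0

/-- The matrix of a path: the product of the matrices of its arrows. -/
def pathMatrix {d : T.Vertex} : ∀ {e : T.Vertex}, Quiver.Path d e → Matrix T.Dart T.Dart K
  | _, .nil => vertexMatrix K T d
  | f, .cons (b := e) π _ => pathMatrix π * arrowMatrix K T e f

variable {K T}

lemma vertexMatrix_mul_apply (d : T.Vertex) (M : Matrix T.Dart T.Dart K) (p q : T.Dart) :
    (vertexMatrix K T d * M) p q = if p.edge = d then M p q else 0 := by
  rw [vertexMatrix, Matrix.diagonal_mul, ite_mul, one_mul, zero_mul]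

lemma mul_vertexMatrix_apply (d : T.Vertex) (M : Matrix T.Dart T.Dart K) (p q : T.Dart) :
    (M * vertexMatrix K T d) p q = if q.edge = d then M p q else 0 := by
  rw [vertexMatrix, Matrix.mul_diagonal, mul_ite, mul_one, mul_zero]

lemma vertexMatrix_mul_vertexMatrix_self (d : T.Vertex) :
    vertexMatrix K T d * vertexMatrix K T d = vertexMatrix K T d := by
  ext p q
  rw [vertexMatrix_mul_apply, vertexMatrix, Matrix.diagonal_apply]
  split_ifs <;> rfl

lemma vertexMatrix_mul_vertexMatrix_of_ne {d e : T.Vertex} (h : d ≠ e) :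
    vertexMatrix K T d * vertexMatrix K T e = 0 := by
  ext p q
  rw [vertexMatrix_mul_apply, vertexMatrix, Matrix.diagonal_apply]
  split_ifs with h₁ h₂ h₃
  · exact absurd (h₁.symm.trans h₃) h
  all_goals rfl

lemma arrowMatrix_mul_vertexMatrix (d e : T.Vertex) :
    arrowMatrix K T d e * vertexMatrix K T e = arrowMatrix K T d e := by
  ext p q
  rw [mul_vertexMatrix_apply, arrowMatrix, Matrix.of_apply]
  by_cases h : q.edge = e <;> simp [h]

lemma vertexMatrix_mul_arrowMatrix (d e : T.Vertex) :
    vertexMatrix K T d * arrowMatrix K T d e = arrowMatrix K T d e := by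
  ext p q
  rw [vertexMatrix_mul_apply, arrowMatrix, Matrix.of_apply]
  by_cases h : p.edge = d <;> simp [h]

lemma pathMatrix_mul_vertexMatrix {d e : T.Vertex} (π : Quiver.Path d e) :
    pathMatrix K T π * vertexMatrix K T e = pathMatrix K T π := by
  cases π with
  | nil => exact vertexMatrix_mul_vertexMatrix_self d
  | cons π α => rw [pathMatrix, mul_assoc, arrowMatrix_mul_vertexMatrix]

lemma vertexMatrix_mul_pathMatrix {d e : T.Vertex} (π : Quiver.Path d e) :
    vertexMatrix K T d * pathMatrix K T π = pathMatrix K T π := by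
  induction π with
  | nil => exact vertexMatrix_mul_vertexMatrix_self d
  | cons π α ih => rw [pathMatrix, ← mul_assoc, ih]

lemma pathMatrix_comp {d e f : T.Vertex} (π : Quiver.Path d e) (ρ : Quiver.Path e f) :
    pathMatrix K T (π.comp ρ) = pathMatrix K T π * pathMatrix K T ρ := by
  induction ρ with
  | nil => exact (pathMatrix_mul_vertexMatrix π).symm
  | cons ρ α ih => rw [Quiver.Path.comp_cons, pathMatrix, ih, pathMatrix, mul_assoc]

variable (K T)

/-- The representation of the path algebra by matrices. -/
def pathAlgebraHom : PathAlgebra K T.Vertex →ₐ[K] Matrix T.Dart T.Dart K :=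
  AlgHom.ofLinearMap (PathAlgebra.lift K fun π => pathMatrix K T π.path)
    (by
      rw [PathAlgebra.one_def, map_sum]
      simp only [PathAlgebra.lift_of]
      ext p q
      rw [Matrix.sum_apply]
      simp only [QuiverPath.trivial, pathMatrix, vertexMatrix, Matrix.diagonal_apply,
        Matrix.one_apply]
      by_cases h : p = q <;> simp [h])
    (by
      intro x y
      have key : (PathAlgebra.mulHom K (V := T.Vertex)).compr₂
          (PathAlgebra.lift K fun π => pathMatrix K T π.path) =
          (LinearMap.mul K (Matrix T.Dart T.Dart K)).compl₁₂
            (PathAlgebra.lift K fun π => pathMatrix K T π.path)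
            (PathAlgebra.lift K fun π => pathMatrix K T π.path) := by
        refine PathAlgebra.hom_ext K fun π => PathAlgebra.hom_ext K fun ρ => ?_
        simp only [LinearMap.compr₂_apply, LinearMap.compl₁₂_apply, LinearMap.mul_apply',
          ← PathAlgebra.mul_def, PathAlgebra.of_mul_of, PathAlgebra.lift_of]
        obtain ⟨a, b, π⟩ := π
        obtain ⟨b', c, ρ⟩ := ρ
        by_cases h : b = b'
        · subst h
          simp only [PathAlgebra.mulPath, dite_true, PathAlgebra.lift_of, QuiverPath.comp,
            Quiver.Path.cast_rfl_rfl, pathMatrix_comp]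
        · simp only [PathAlgebra.mulPath, h, dite_false, map_zero]
          rw [← pathMatrix_mul_vertexMatrix π, ← vertexMatrix_mul_pathMatrix ρ, mul_assoc,
            ← mul_assoc (vertexMatrix K T b), vertexMatrix_mul_vertexMatrix_of_ne h, zero_mul,
            mul_zero]
      exact LinearMap.congr_fun (LinearMap.congr_fun key x) y)

lemma pathAlgebraHom_of (π : QuiverPath T.Vertex) :
    pathAlgebraHom K T (PathAlgebra.of K π) = pathMatrix K T π.path :=
  PathAlgebra.lift_of K _ π

variable {K T}

lemma pathAlgebraHom_eq_zero {x : PathAlgebra K T.Vertex} (hx : x ∈ T.relations K) :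
    pathAlgebraHom K T x = 0 := by
  obtain ⟨d, e, f, α, β, ⟨R, hR, hd, he, hf⟩, rfl⟩ := hx
  rw [pathAlgebraHom_of]
  change vertexMatrix K T d * arrowMatrix K T d e * arrowMatrix K T e f = 0
  rw [vertexMatrix_mul_arrowMatrix]
  ext p r
  rw [Matrix.mul_apply]
  refine Finset.sum_eq_zero fun q _ => ?_
  simp only [arrowMatrix, Matrix.of_apply]
  by_cases h : p.edge = d ∧ q.edge = e ∧ p < q
  · obtain ⟨rfl, rfl, hpq⟩ := h
    have hqr : ¬ (q.edge = q.edge ∧ r.edge = f ∧ q < r) := by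
      rintro ⟨-, rfl, hqr⟩
      exact not_lt_of_bounds hR hd hf hpq hqr
    rw [if_neg hqr, mul_zero]
  · rw [if_neg h, zero_mul]

variable (K T)

/-- The representation of the tiling algebra by matrices. -/
def tilingAlgebraHom : T.tilingAlgebra K →ₐ[K] Matrix T.Dart T.Dart K :=
  RingCon.liftₐ _ (pathAlgebraHom K T) fun x y hxy => by
    have h : TwoSidedIdeal.span (T.relations K) ≤
        TwoSidedIdeal.ker (pathAlgebraHom K T).toRingHom :=
      TwoSidedIdeal.span_le.2 fun x hx =>
        (TwoSidedIdeal.mem_ker _).2 (pathAlgebraHom_eq_zero hx)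
    have h' := (TwoSidedIdeal.mem_ker _).1 (h ((TwoSidedIdeal.rel_iff _ _ _).1 hxy))
    rw [map_sub, sub_eq_zero] at h'
    exact h'

/-- The projection of the path algebra onto the tiling algebra. -/
def proj : PathAlgebra K T.Vertex →ₐ[K] T.tilingAlgebra K := RingCon.mkₐ K _

lemma proj_surjective : Function.Surjective (proj K T) := RingCon.mkₐ_surjective _

lemma tilingAlgebraHom_proj (x : PathAlgebra K T.Vertex) :
    tilingAlgebraHom K T (proj K T x) = pathAlgebraHom K T x := rfl

/-- The class of a path in the tiling algebra. -/
def pathClass {d e : T.Vertex} (π : Quiver.Path d e) : T.tilingAlgebra K :=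
  proj K T (PathAlgebra.of K ⟨d, e, π⟩)

/-- The class of the arrow from `d` to `e` in the tiling algebra, or zero if there is none. -/
def arrowClass (d e : T.Vertex) : T.tilingAlgebra K :=
  if h : T.IsArrow d e then pathClass K T (Quiver.Hom.toPath (V := T.Vertex) (PLift.up h)) else 0

variable {K T}

lemma tilingAlgebraHom_pathClass {d e : T.Vertex} (π : Quiver.Path d e) :
    tilingAlgebraHom K T (pathClass K T π) = pathMatrix K T π := by
  rw [pathClass, tilingAlgebraHom_proj, pathAlgebraHom_of]

lemma arrowClass_eq {d e : T.Vertex} (α : d ⟶ e) :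
    arrowClass K T d e = pathClass K T α.toPath := dif_pos α.down

lemma pathClass_comp {d e f : T.Vertex} (π : Quiver.Path d e) (ρ : Quiver.Path e f) :
    pathClass K T (π.comp ρ) = pathClass K T π * pathClass K T ρ := by
  rw [pathClass, pathClass, pathClass, ← map_mul, PathAlgebra.of_mul_of, PathAlgebra.mulPath,
    dif_pos rfl]
  rfl

lemma pathClass_cons {d e f : T.Vertex} (π : Quiver.Path d e) (α : e ⟶ f) :
    pathClass K T (π.cons α) = pathClass K T π * arrowClass K T e f := by
  rw [arrowClass_eq α, ← pathClass_comp]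
  rfl

lemma isArrow_of_covBy {p q : T.Dart} (h : p ⋖ q) : T.IsArrow p.edge q.edge :=
  isArrow_iff.2 ⟨p, q, rfl, rfl, h⟩

lemma arrowClass_mul_arrowClass {p q r : T.Dart} (h : p ⋖ q) (h' : q.swap ⋖ r) :
    arrowClass K T p.edge q.edge * arrowClass K T q.edge r.edge = 0 := by
  have h₁ := isArrow_of_covBy h
  have h₂ := isArrow_of_covBy h'
  rw [Dart.edge_swap] at h₂
  let α : p.edge ⟶ q.edge := PLift.up h₁
  let β : q.edge ⟶ r.edge := PLift.up h₂
  rw [arrowClass_eq α, arrowClass_eq β, ← pathClass_comp]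
  have hmem : PathAlgebra.of K ⟨p.edge, r.edge, α.toPath.comp β.toPath⟩ ∈
      TwoSidedIdeal.span (T.relations K) :=
    TwoSidedIdeal.subset_span ⟨_, _, _, α, β, exists_isTile_of_covBy_swap h h', rfl⟩
  have hrel := (TwoSidedIdeal.mem_iff _ _).1 hmem
  exact ((RingCon.eq _).2 hrel).trans (map_zero (proj K T))

/-- Two diagonals share at most one marked point. -/
lemma eq_of_edge_eq_of_lt {p p' q q' : T.Dart} (hp : p'.edge = p.edge) (hq : q'.edge = q.edge)
    (h : p < q) (h' : p' < q') : p' = p ∧ q' = q := by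
  have h₁ := h.1
  have h₂ := h'.1
  have h₃ : p.tip ≠ q.tip := fun h₃ => sbtw_irrefl_right (h₃ ▸ h.2)
  have h₄ := p.base_ne_tip
  have h₅ := q.base_ne_tip
  rcases Dart.edge_eq_iff.1 hp with rfl | rfl <;> rcases Dart.edge_eq_iff.1 hq with rfl | rfl
  · exact ⟨rfl, rfl⟩
  · exact absurd (h₁.symm.trans h₂) h₅
  · exact absurd (h₁.trans h₂.symm) h₄
  · exact absurd h₂ h₃

lemma arrowMatrix_eq_single {p q : T.Dart} (h : p < q) :
    arrowMatrix K T p.edge q.edge = Matrix.single p q 1 := by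
  ext r s
  rw [arrowMatrix, Matrix.of_apply, Matrix.single_apply]
  refine if_congr ⟨?_, ?_⟩ rfl rfl
  · rintro ⟨h₁, h₂, h₃⟩
    obtain ⟨rfl, rfl⟩ := eq_of_edge_eq_of_lt h₁ h₂ h h₃
    exact ⟨rfl, rfl⟩
  · rintro ⟨rfl, rfl⟩
    exact ⟨rfl, rfl, h⟩

/-- `IsFanPath p q a` says that `a` is the class of the path from the diagonal of `p` to that of
`q` that turns around their common marked point. -/
inductive IsFanPath (p : T.Dart) : T.Dart → T.tilingAlgebra K → Prop
  | refl : IsFanPath p p (pathClass K T (Quiver.Path.nil (a := p.edge)))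
  | step {q r : T.Dart} {a : T.tilingAlgebra K} : IsFanPath p q a → q ⋖ r →
      IsFanPath p r (a * arrowClass K T q.edge r.edge)

lemma exists_covBy_of_le_of_lt {p q : T.Dart} (h : p < q) : ∃ r, p ≤ r ∧ r ⋖ q := by
  obtain ⟨r, hr, hmax⟩ := Finite.exists_le_maximal (p := fun r : T.Dart => r < q) h
  exact ⟨r, hr, hmax.prop, fun s hrs hsq => hmax.not_gt hsq hrs⟩

lemma covBy_left_unique {p p' q : T.Dart} (h : p ⋖ q) (h' : p' ⋖ q) : p = p' := by
  have hb : p.base = p'.base := h.lt.1.trans h'.lt.1.symm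
  rcases Dart.comparable_iff.2 hb with h₁ | h₁
  · exact h₁.lt_or_eq.resolve_left fun h₂ => h.2 h₂ h'.lt
  · exact (h₁.lt_or_eq.resolve_left fun h₂ => h'.2 h₂ h.lt).symm

lemma IsFanPath.le {p q : T.Dart} {a : T.tilingAlgebra K} (h : IsFanPath p q a) : p ≤ q := by
  induction h with
  | refl => exact le_rfl
  | step _ hqr ih => exact ih.trans hqr.le

lemma exists_isFanPath {p q : T.Dart} (h : p ≤ q) : ∃ a : T.tilingAlgebra K, IsFanPath p q a := by
  induction q using WellFoundedLT.induction with
  | _ q ih =>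
    rcases h.lt_or_eq with h' | rfl
    · obtain ⟨r, hpr, hrq⟩ := exists_covBy_of_le_of_lt h'
      obtain ⟨a, ha⟩ := ih r hrq.lt hpr
      exact ⟨_, ha.step hrq⟩
    · exact ⟨_, IsFanPath.refl⟩

lemma IsFanPath.unique {p q : T.Dart} {a b : T.tilingAlgebra K} (ha : IsFanPath p q a)
    (hb : IsFanPath p q b) : a = b := by
  induction ha generalizing b with
  | refl =>
    cases hb with
    | refl => rfl
    | step h hq => exact absurd (h.le.trans_lt hq.lt) (lt_irrefl p)
  | step h hq ih =>
    cases hb with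
    | refl => exact absurd (h.le.trans_lt hq.lt) (lt_irrefl p)
    | step h' hq' =>
      obtain rfl := covBy_left_unique hq hq'
      rw [ih h']

variable (K) in
/-- The class of the path from the diagonal of `p` to that of `q` that turns around their common
marked point if `p < q`, and zero otherwise. -/
def fanClass (p q : T.Dart) : T.tilingAlgebra K :=
  if h : p < q then (exists_isFanPath h.le).choose else 0

lemma isFanPath_fanClass {p q : T.Dart} (h : p < q) : IsFanPath p q (fanClass K p q) := by
  rw [fanClass, dif_pos h]
  exact (exists_isFanPath h.le).choose_spec

lemma fanClass_mul_arrowClass {p q r : T.Dart} (h : p < q) (h' : q ⋖ r) :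
    fanClass K p q * arrowClass K T q.edge r.edge = fanClass K p r :=
  ((isFanPath_fanClass h).step h').unique (isFanPath_fanClass (h.trans h'.lt))

/-- An arrow that turns around the other endpoint of the last diagonal of a path forms a relation
with the last arrow of the path. -/
lemma fanClass_mul_arrowClass_eq_zero {p q r : T.Dart} (h : p < q) (h' : q.swap ⋖ r) :
    fanClass K p q * arrowClass K T q.edge r.edge = 0 := by
  obtain ⟨s, hps, hsq⟩ := exists_covBy_of_le_of_lt h
  obtain ⟨a, ha⟩ := exists_isFanPath (K := K) hps
  rw [(isFanPath_fanClass h).unique (ha.step hsq), mul_assoc, arrowClass_mul_arrowClass hsq h',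
    mul_zero]

lemma tilingAlgebraHom_arrowClass {p q : T.Dart} (h : p ⋖ q) :
    tilingAlgebraHom K T (arrowClass K T p.edge q.edge) = Matrix.single p q 1 := by
  let α : p.edge ⟶ q.edge := PLift.up (isArrow_of_covBy h)
  rw [arrowClass_eq α, tilingAlgebraHom_pathClass]
  change vertexMatrix K T p.edge * arrowMatrix K T p.edge q.edge = _
  rw [vertexMatrix_mul_arrowMatrix, arrowMatrix_eq_single h.lt]

lemma vertexMatrix_mul_single {p q : T.Dart} :
    vertexMatrix K T p.edge * Matrix.single p q 1 = Matrix.single p q 1 := by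
  ext r s
  rw [vertexMatrix_mul_apply, Matrix.single_apply]
  by_cases h : p = r ∧ q = s
  · rw [if_pos h, h.1, if_pos rfl]
  · rw [if_neg h, ite_self]

lemma tilingAlgebraHom_fanClass (p q : T.Dart) : tilingAlgebraHom K T (fanClass K p q) =
    if p < q then Matrix.single p q 1 else 0 := by
  by_cases h : p < q
  · rw [if_pos h]
    have key : ∀ {r a}, IsFanPath p r a →
        tilingAlgebraHom K T a =
          if p < r then Matrix.single p r 1 else vertexMatrix K T p.edge := by
      intro r a ha
      induction ha with
      | refl =>
        rw [tilingAlgebraHom_pathClass, if_neg (lt_irrefl p)]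
        rfl
      | step h hqr ih =>
        rw [map_mul, ih, tilingAlgebraHom_arrowClass hqr, if_pos (h.le.trans_lt hqr.lt)]
        split_ifs with h'
        · rw [Matrix.single_mul_single_same, one_mul]
        · obtain rfl := h.le.lt_or_eq.resolve_left h'
          exact vertexMatrix_mul_single
    rw [key (isFanPath_fanClass h), if_pos h]
  · rw [if_neg h, fanClass, dif_neg h, map_zero]

/-- The linear map that sends the matrix units at `p < q` and the matrices of the diagonals to the
corresponding classes of paths. On the image of `tilingAlgebraHom` it is the inverse. -/
def ofMatrix : Matrix T.Dart T.Dart K →ₗ[K] T.tilingAlgebra K where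
  toFun M := ∑ p, ((∑ q, M p q • fanClass K p q) +
    if T.fanSystem.sign p = 1 then M p p • pathClass K T (Quiver.Path.nil (a := p.edge)) else 0)
  map_add' M N := by
    rw [← Finset.sum_add_distrib]
    refine Finset.sum_congr rfl fun p _ => ?_
    simp only [Matrix.add_apply, add_smul, Finset.sum_add_distrib]
    split_ifs <;> abel
  map_smul' k M := by
    rw [RingHom.id_apply, Finset.smul_sum]
    refine Finset.sum_congr rfl fun p _ => ?_
    simp only [Matrix.smul_apply, smul_assoc, smul_add, Finset.smul_sum]
    split_ifs <;> simp

lemma ofMatrix_apply (M : Matrix T.Dart T.Dart K) :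
    ofMatrix M = ∑ p, ((∑ q, M p q • fanClass K p q) +
    if T.fanSystem.sign p = 1 then M p p • pathClass K T (Quiver.Path.nil (a := p.edge)) else 0) :=
  rfl

lemma ofMatrix_single {p q : T.Dart} (h : p < q) :
    ofMatrix (Matrix.single p q 1) = fanClass K p q := by
  rw [ofMatrix_apply, Finset.sum_eq_single p, Finset.sum_eq_single q]
  · simp [h.ne']
  · intro r _ hr
    simp [hr.symm]
  · simp
  · intro r _ hr
    simp [hr.symm]
  · simp

lemma vertexMatrix_edge (p : T.Dart) :
    vertexMatrix K T p.edge = T.fanSystem.edgeMatrix K p := by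
  unfold vertexMatrix FanSystem.edgeMatrix
  congr 1
  funext q
  exact if_congr Dart.edge_eq_iff rfl rfl

lemma exists_sign_eq_one (d : T.Vertex) : ∃ p : T.Dart, p.edge = d ∧ T.fanSystem.sign p = 1 := by
  obtain ⟨p, rfl⟩ := Dart.exists_edge_eq d
  obtain h | h := Int.units_eq_one_or (T.fanSystem.sign p)
  · exact ⟨p, rfl, h⟩
  · refine ⟨p.swap, Dart.edge_swap p, ?_⟩
    rw [← fanSystem_swap, FanSystem.sign_swap, h, neg_neg]

lemma ofMatrix_vertexMatrix (d : T.Vertex) :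
    ofMatrix (vertexMatrix K T d) = pathClass K T (Quiver.Path.nil (a := d)) := by
  obtain ⟨p, rfl, hp⟩ := exists_sign_eq_one d
  have h₀ (q r : T.Dart) : vertexMatrix K T p.edge q r • fanClass K q r = 0 := by
    by_cases h : q = r
    · rw [h, fanClass, dif_neg (lt_irrefl r), smul_zero]
    · rw [vertexMatrix, Matrix.diagonal_apply_ne _ h, zero_smul]
  rw [ofMatrix_apply]
  simp only [h₀, Finset.sum_const_zero, zero_add]
  rw [Finset.sum_eq_single p]
  · rw [if_pos hp, vertexMatrix, Matrix.diagonal_apply_eq, if_pos rfl, one_smul]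
  · intro q _ hq
    split_ifs with h
    · rw [vertexMatrix, Matrix.diagonal_apply_eq, if_neg, zero_smul]
      intro h'
      rcases Dart.edge_eq_iff.1 h' with rfl | rfl
      · exact hq rfl
      · rw [← fanSystem_swap, FanSystem.sign_swap, hp] at h
        exact absurd h (by decide)
    · rfl
  · simp

/-- A path is trivial, or it turns around a single marked point, or its class is zero. -/
lemma pathClass_cases {d e : T.Vertex} (π : Quiver.Path d e) :
    (∃ h : d = e, π = h ▸ Quiver.Path.nil) ∨
    (pathClass K T π = 0 ∧ pathMatrix K T π = 0) ∨
    ∃ p q : T.Dart, p < q ∧ q.edge = e ∧ pathClass K T π = fanClass K p q ∧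
      pathMatrix K T π = Matrix.single p q 1 := by
  induction π with
  | nil => exact Or.inl ⟨rfl, rfl⟩
  | cons π α ih =>
    refine Or.inr ?_
    obtain ⟨q, r, rfl, rfl, hqr⟩ := isArrow_iff.1 α.down
    rw [pathClass_cons, pathMatrix, arrowMatrix_eq_single hqr.lt]
    obtain ⟨rfl, rfl⟩ | ⟨h, h'⟩ | ⟨p, s, hps, hs, h, h'⟩ := ih
    · refine Or.inr ⟨q, r, hqr.lt, rfl, ?_, vertexMatrix_mul_single⟩
      exact (IsFanPath.refl.step hqr).unique (isFanPath_fanClass hqr.lt)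
    · exact Or.inl ⟨by rw [h, zero_mul], by rw [h', zero_mul]⟩
    · rw [h, h']
      rcases Dart.edge_eq_iff.1 hs with rfl | rfl
      · exact Or.inr ⟨p, r, hps.trans hqr.lt, rfl, fanClass_mul_arrowClass hps hqr, by
          rw [Matrix.single_mul_single_same, one_mul]⟩
      · refine Or.inl ⟨?_, Matrix.single_mul_single_of_ne _ _ _ _ ?_ _⟩
        · have := fanClass_mul_arrowClass_eq_zero (K := K) hps (r := r) hqr
          rwa [Dart.edge_swap] at this
        · exact T.fanSystem.swap_ne q

lemma ofMatrix_pathMatrix {d e : T.Vertex} (π : Quiver.Path d e) :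
    ofMatrix (pathMatrix K T π) = pathClass K T π := by
  obtain ⟨rfl, rfl⟩ | ⟨h, h'⟩ | ⟨p, q, hpq, -, h, h'⟩ := pathClass_cases (K := K) π
  · exact ofMatrix_vertexMatrix d
  · rw [h, h', map_zero]
  · rw [h, h', ofMatrix_single hpq]

lemma ofMatrix_tilingAlgebraHom (a : T.tilingAlgebra K) :
    ofMatrix (tilingAlgebraHom K T a) = a := by
  obtain ⟨x, rfl⟩ := proj_surjective K T a
  have key : ofMatrix ∘ₗ (pathAlgebraHom K T).toLinearMap = (proj K T).toLinearMap := by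
    refine PathAlgebra.hom_ext K fun π => ?_
    change ofMatrix (pathAlgebraHom K T (PathAlgebra.of K π)) = _
    rw [pathAlgebraHom_of, ofMatrix_pathMatrix]
    rfl
  exact LinearMap.congr_fun key x

/-- The matrices of the tiling algebra are upper triangular on the fans, and their diagonal entries
at the two darts of a diagonal agree. -/
lemma pathMatrix_apply {d e : T.Vertex} (π : Quiver.Path d e) :
    (∀ p q, pathMatrix K T π p q ≠ 0 → p ≤ q) ∧
      ∀ p : T.Dart, pathMatrix K T π p.swap p.swap = pathMatrix K T π p p := by
  obtain ⟨rfl, rfl⟩ | ⟨-, h⟩ | ⟨r, s, hrs, -, -, h⟩ := pathClass_cases (K := K) π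
  · constructor
    · intro p q h
      by_contra hle
      exact h (Matrix.diagonal_apply_ne _ fun h' => hle h'.le)
    · intro p
      change vertexMatrix K T d _ _ = vertexMatrix K T d _ _
      rw [vertexMatrix, Matrix.diagonal_apply_eq, Matrix.diagonal_apply_eq, Dart.edge_swap]
  · rw [h]
    exact ⟨fun p q h => absurd rfl h, fun p => rfl⟩
  · rw [h]
    have h₀ (p : T.Dart) : Matrix.single r s (1 : K) p p = 0 := by
      refine Matrix.single_apply_of_ne _ _ _ _ _ ?_
      rintro ⟨rfl, rfl⟩
      exact hrs.false
    refine ⟨fun p q hpq => ?_, fun p => by rw [h₀, h₀]⟩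
    by_contra hle
    refine hpq (Matrix.single_apply_of_ne _ _ _ _ _ ?_)
    rintro ⟨rfl, rfl⟩
    exact hle hrs.le

variable (K T)

/-- The tiling algebra realizes the fan system of the tiling. -/
def realization : T.fanSystem.Realization K (T.tilingAlgebra K) where
  toMatrix := tilingAlgebraHom K T
  injective := Function.LeftInverse.injective ofMatrix_tilingAlgebraHom
  le_of_ne_zero a p q h := by
    by_contra hle
    obtain ⟨x, rfl⟩ := proj_surjective K T a
    refine h ?_
    have key : Matrix.entryLinearMap K K p q ∘ₗ (pathAlgebraHom K T).toLinearMap = 0 := by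
      refine PathAlgebra.hom_ext K fun π => ?_
      change pathAlgebraHom K T (PathAlgebra.of K π) p q = 0
      rw [pathAlgebraHom_of]
      by_contra h'
      exact hle ((pathMatrix_apply π.path).1 p q h')
    exact LinearMap.congr_fun key x
  apply_swap a p := by
    obtain ⟨x, rfl⟩ := proj_surjective K T a
    have key : Matrix.entryLinearMap K K p.swap p.swap ∘ₗ (pathAlgebraHom K T).toLinearMap =
        Matrix.entryLinearMap K K p p ∘ₗ (pathAlgebraHom K T).toLinearMap := by
      refine PathAlgebra.hom_ext K fun π => ?_
      change pathAlgebraHom K T (PathAlgebra.of K π) p.swap p.swap =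
        pathAlgebraHom K T (PathAlgebra.of K π) p p
      rw [pathAlgebraHom_of]
      exact (pathMatrix_apply π.path).2 p
    exact LinearMap.congr_fun key x
  exists_eq M hM hswap := by
    refine ⟨ofMatrix M, ?_⟩
    conv_rhs => rw [T.fanSystem.matrix_eq_sum M hM hswap]
    rw [ofMatrix_apply, map_sum]
    refine Finset.sum_congr rfl fun p _ => ?_
    simp only [map_add, map_sum, map_smul, tilingAlgebraHom_fanClass]
    congr 1
    split_ifs
    · rw [map_smul, tilingAlgebraHom_pathClass, ← vertexMatrix_edge]
      rfl
    · rw [map_zero]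

/-! ### Open tiles and chains -/

variable {n : ℕ}

/-- The position of the marked point `j` in the clockwise order that starts just after the boundary
segment `i`. -/
def offset (i j : Fin n) : ℕ := if j ≤ i then j + (n - 1 - i) else j - i - 1

lemma offset_cases (i j : Fin n) : ((j : ℕ) ≤ i ∧ offset i j = j + (n - 1 - i)) ∨
    ((i : ℕ) < j ∧ offset i j = j - i - 1) := by
  unfold offset
  split_ifs with h
  · exact Or.inl ⟨h, rfl⟩
  · exact Or.inr ⟨not_le.1 h, rfl⟩

lemma offset_injective (i : Fin n) : Function.Injective (offset i) := fun a b h => by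
  have := offset_cases i a
  have := offset_cases i b
  rw [Fin.ext_iff]
  omega

lemma offset_le_offset_self (i j : Fin n) : offset i j ≤ offset i i := by
  have := offset_cases i j
  have := offset_cases i i
  omega

lemma sbtw_iff_offset (i : Fin n) {a b c : Fin n} : sbtw a b c ↔
    offset i a < offset i b ∧ offset i b < offset i c ∨
    offset i b < offset i c ∧ offset i c < offset i a ∨
    offset i c < offset i a ∧ offset i a < offset i b := by
  have := offset_cases i a
  have := offset_cases i b
  have := offset_cases i c
  rw [sbtw_iff_val]
  omega

lemma separates_segment_point {d : Sym2 (Fin n)} {i v : Fin n} :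
    Separates d (BoundaryPiece.segment i) (BoundaryPiece.point v) ↔
      ∃ u w, d = s(u, w) ∧ offset i u < offset i v ∧ offset i v < offset i w := by
  constructor
  · rintro ⟨a, b, rfl, h, h'⟩
    refine ⟨b, a, Sym2.eq_swap, ?_⟩
    have := offset_cases i a
    have := offset_cases i b
    have := offset_cases i v
    simp only [sbtw_iff_val, BoundaryPiece.pos] at h h'
    omega
  · rintro ⟨u, w, rfl, h⟩
    refine ⟨w, u, Sym2.eq_swap, ?_⟩
    have := offset_cases i u
    have := offset_cases i w
    have := offset_cases i v
    simp only [sbtw_iff_val, BoundaryPiece.pos]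
    omega

lemma separates_segment_or {d : Sym2 (Fin n)} {p q : BoundaryPiece n} (i : Fin n)
    (h : Separates d p q) :
    Separates d (BoundaryPiece.segment i) p ∨ Separates d (BoundaryPiece.segment i) q := by
  obtain ⟨a, b, rfl, h₁, h₂⟩ := h
  have h₃ : sbtw (BoundaryPiece.point a).pos (BoundaryPiece.segment i).pos
      (BoundaryPiece.point b).pos ∨ sbtw (BoundaryPiece.point b).pos (BoundaryPiece.segment i).pos
      (BoundaryPiece.point a).pos := by
    simp only [sbtw_iff_val, BoundaryPiece.pos] at h₁ ⊢
    omega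
  rcases h₃ with h₃ | h₃
  · exact Or.inr ⟨a, b, rfl, h₃, h₂⟩
  · exact Or.inl ⟨b, a, Sym2.eq_swap, h₃, h₁⟩

variable (T : Tiling n)

/-- The tile that contains the boundary segment `i`. It consists of the boundary pieces that no
diagonal separates from the segment. -/
def segmentTile (i : Fin n) : Set (BoundaryPiece n) :=
  {p | ∀ d ∈ T.diagonals, ¬ Separates d (BoundaryPiece.segment i) p}

variable {T}

lemma segment_mem_segmentTile (i : Fin n) : BoundaryPiece.segment i ∈ T.segmentTile i := by
  rintro d - ⟨a, b, rfl, h, h'⟩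
  simp only [sbtw_iff_val, BoundaryPiece.pos] at h h'
  omega

lemma isTile_segmentTile (i : Fin n) : T.IsTile (T.segmentTile i) := by
  refine ⟨fun p hp q hq d hd h => ?_, fun S hS hRS q hq d hd => ?_⟩
  · exact (separates_segment_or i h).elim (hp d hd) (hq d hd)
  · exact hS _ (hRS (segment_mem_segmentTile i)) _ hq d hd

lemma eq_segmentTile {R : Set (BoundaryPiece n)} (hR : T.IsTile R) {i : Fin n}
    (hi : BoundaryPiece.segment i ∈ R) : R = T.segmentTile i :=
  hR.eq_of_le (isTile_segmentTile i).prop fun q hq d hd => hR.prop _ hi q hq d hd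

lemma point_mem_segmentTile {i v : Fin n} :
    BoundaryPiece.point v ∈ T.segmentTile i ↔ ∀ u w, s(u, w) ∈ T.diagonals →
      offset i u < offset i v → ¬ offset i v < offset i w := by
  constructor
  · intro h u w huw h₁ h₂
    exact h _ huw (separates_segment_point.2 ⟨u, w, rfl, h₁, h₂⟩)
  · intro h d hd hsep
    obtain ⟨u, w, rfl, h₁, h₂⟩ := separates_segment_point.1 hsep
    exact h u w hd h₁ h₂

lemma offset_not_cross (i : Fin n) {a b c d : Fin n} (h : s(a, b) ∈ T.diagonals)
    (h' : s(c, d) ∈ T.diagonals) (hac : offset i a < offset i c) (hcb : offset i c < offset i b) :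
    ¬ offset i b < offset i d := fun hbd =>
  T.not_sbtw_of_sbtw h h' ((sbtw_iff_offset i).2 (Or.inl ⟨hac, hcb⟩))
    ((sbtw_iff_offset i).2 (by omega))

/-- The dart `p` runs along the boundary of the tile of the segment `i`, and its tip is the first of
its two endpoints clockwise from the segment. -/
structure Borders (i : Fin n) (p : T.Dart) : Prop where
  base_mem : BoundaryPiece.point p.base ∈ T.segmentTile i
  tip_mem : BoundaryPiece.point p.tip ∈ T.segmentTile i
  lt : offset i p.tip < offset i p.base

/-- The first dart at a marked point borders the tile of any segment from which no endpoint of a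
diagonal is further away. -/
lemma borders_of_minimal {i : Fin n} {p : T.Dart} (hp : ∀ r, ¬ r < p)
    (hmax : ∀ q : T.Dart, offset i q.base ≤ offset i p.base) : Borders i p := by
  have hlt : offset i p.tip < offset i p.base :=
    lt_of_le_of_ne (hmax p.swap) fun h => p.base_ne_tip (offset_injective i h).symm
  refine ⟨point_mem_segmentTile.2 fun u w huw _ h => ?_,
    point_mem_segmentTile.2 fun u w huw h₁ h₂ => ?_, hlt⟩
  · have := hmax (Dart.mk huw).swap
    simp only [Dart.base_swap, Dart.tip_mk] at this
    omega
  · have h₃ := hmax (Dart.mk huw).swap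
    simp only [Dart.base_swap, Dart.tip_mk] at h₃
    have h₄ := offset_not_cross i huw p.swap.mem h₁ h₂
    simp only [Dart.tip_swap] at h₄
    obtain rfl : w = p.base := offset_injective i (by omega)
    exact hp (Dart.mk huw).swap ⟨rfl, (sbtw_iff_offset i).2 (by
      simp only [Dart.base_swap, Dart.tip_swap, Dart.tip_mk, Dart.base_mk]
      omega)⟩

/-- The next dart of a chain borders the same tile. -/
lemma Borders.next {i : Fin n} {p q : T.Dart} (h : Borders i p) (hpq : p.swap ⋖ q) :
    Borders i q ∧ q.base = p.tip := by
  have hb : q.base = p.tip := hpq.lt.1.symm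
  have hs := (sbtw_iff_offset i).1 hpq.lt.2
  simp only [Dart.base_swap, Dart.tip_swap] at hs
  have hqm : s(p.tip, q.tip) ∈ T.diagonals := hb ▸ q.mem
  have hlt := h.lt
  have h₁ := point_mem_segmentTile.1 h.base_mem p.tip q.tip hqm hlt
  have hlt' : offset i q.tip < offset i p.tip := by omega
  refine ⟨⟨hb ▸ h.tip_mem, point_mem_segmentTile.2 fun u w huw h₂ h₃ => ?_, hb ▸ hlt'⟩, hb⟩
  have h₄ := offset_not_cross i huw (Sym2.eq_swap (a := p.tip) ▸ hqm) h₂ h₃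
  have h₅ := point_mem_segmentTile.1 h.tip_mem u w huw (by omega)
  obtain rfl : w = p.tip := offset_injective i (by omega)
  -- a diagonal that cuts off the tip of `q` would start between `p.swap` and `q`
  refine hpq.2 (c := (Dart.mk huw).swap) ⟨rfl, (sbtw_iff_offset i).2 ?_⟩
    ⟨hb.symm, (sbtw_iff_offset i).2 ?_⟩ <;>
  · simp only [Dart.base_swap, Dart.tip_swap, Dart.tip_mk, Dart.base_mk]
    omega

/-- The diagonals that bound the tile of the segment `i` and do not reach beyond offset `m`. -/
def boundingDiagonals (T : Tiling n) (i : Fin n) (m : ℕ) : Set (Sym2 (Fin n)) :=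
  {d | T.Bounds d (T.segmentTile i) ∧ ∀ a ∈ d, offset i a ≤ m}

lemma finite_boundingDiagonals (i : Fin n) (m : ℕ) : (T.boundingDiagonals i m).Finite :=
  T.diagonals.finite_toSet.subset fun _ hd => hd.1.1

lemma Borders.edge_mem {i : Fin n} {p : T.Dart} (h : Borders i p) :
    p.edge.1 ∈ T.boundingDiagonals i (offset i p.base) := by
  refine ⟨⟨p.mem, fun a ha => ?_⟩, fun a ha => ?_⟩
  · rcases Sym2.mem_iff.1 ha with rfl | rfl
    · exact h.base_mem
    · exact h.tip_mem
  · rcases Sym2.mem_iff.1 ha with rfl | rfl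
    · exact le_rfl
    · exact h.lt.le

lemma Borders.edge_notMem {i : Fin n} {p : T.Dart} (h : Borders i p) :
    p.edge.1 ∉ T.boundingDiagonals i (offset i p.tip) := fun h' =>
  absurd (h'.2 p.base (Sym2.mem_mk_left _ _)) (not_le.2 h.lt)

/-- Along the boundary of an open tile there is no other diagonal between the two endpoints of a
bounding diagonal. -/
lemma Borders.boundingDiagonals_eq {i : Fin n} {p : T.Dart} (h : Borders i p) :
    T.boundingDiagonals i (offset i p.base) =
      insert p.edge.1 (T.boundingDiagonals i (offset i p.tip)) := by
  refine Set.Subset.antisymm (fun d hd => ?_) (Set.insert_subset h.edge_mem fun d hd =>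
    ⟨hd.1, fun a ha => (hd.2 a ha).trans h.lt.le⟩)
  obtain ⟨⟨hdT, hdR⟩, hle⟩ := hd
  by_cases hall : ∀ a ∈ d, offset i a ≤ offset i p.tip
  · exact Or.inr ⟨⟨hdT, hdR⟩, hall⟩
  · push Not at hall
    obtain ⟨v, hv, hvt⟩ := hall
    obtain ⟨u, rfl⟩ := Sym2.mem_iff_exists.1 hv
    have hpm := p.swap.mem
    simp only [Dart.base_swap, Dart.tip_swap] at hpm
    have h₁ := point_mem_segmentTile.1 (hdR v hv) _ _ hpm hvt
    have h₂ := hle v hv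
    obtain rfl : v = p.base := offset_injective i (by omega)
    have h₃ := hle u (Sym2.mem_mk_right _ _)
    have h₄ := point_mem_segmentTile.1 (hdR u (Sym2.mem_mk_right _ _)) _ _ hpm
    have h₅ := point_mem_segmentTile.1 h.tip_mem u p.base (Sym2.eq_swap (a := p.base) ▸ hdT)
    have h₆ := h.lt
    have h₇ : u ≠ p.base := fun h₇ => T.endpoints_ne _ hdT (Sym2.mk_isDiag_iff.2 h₇.symm)
    have h₈ : offset i u ≠ offset i p.base := fun h₈ => h₇ (offset_injective i h₈)
    obtain rfl : u = p.tip := offset_injective i (by omega)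
    exact Or.inl rfl

lemma le_ncard_of_chain {i : Fin n} {p : T.Dart} {l : ℕ} (h : T.fanSystem.Chain p l)
    (hp : Borders i p) : l ≤ (T.boundingDiagonals i (offset i p.base)).ncard := by
  induction h with
  | one p _ =>
    exact (Set.ncard_pos (finite_boundingDiagonals _ _)).2 ⟨_, hp.edge_mem⟩
  | succ p q l hpq _ ih =>
    obtain ⟨hq, hb⟩ := hp.next hpq
    rw [hp.boundingDiagonals_eq, Set.ncard_insert_of_notMem hp.edge_notMem
      (finite_boundingDiagonals _ _), ← hb]
    exact Nat.succ_le_succ (ih hq)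

/-- In a connected tiling, a property that holds for one diagonal and fails for another one changes
along an arrow. -/
lemma exists_covBy_of_isConnected (hT : T.IsConnected) (c : T.Vertex → Prop) {d e : T.Vertex}
    (hd : c d) (he : ¬ c e) :
    ∃ p q : T.Dart, (p ⋖ q ∨ q ⋖ p) ∧ c p.edge ∧ ¬ c q.edge := by
  obtain ⟨π⟩ := (Quiver.WeaklyConnectedComponent.eq _ _).1 (hT.elim
    (Quiver.WeaklyConnectedComponent.mk d) (Quiver.WeaklyConnectedComponent.mk e))
  induction π with
  | nil => exact absurd hd he
  | @cons f e π α ih =>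
    by_cases hf : c f
    · rcases α with α | α
      · obtain ⟨p, q, rfl, rfl, h⟩ := isArrow_iff.1 (PLift.down α)
        exact ⟨p, q, Or.inl h, hf, he⟩
      · obtain ⟨p, q, rfl, rfl, h⟩ := isArrow_iff.1 (PLift.down α)
        exact ⟨q, p, Or.inr h, hf, he⟩
    · exact ih hf

/-- A chain along the boundary of an open tile of a connected tiling only stops when all bounding
diagonals are exhausted: diagonals beyond its end would not be connected to it. -/
lemma ncard_le_of_chain (hT : T.IsConnected) {i : Fin n} {p : T.Dart} {l : ℕ}
    (h : T.fanSystem.Chain p l) (hp : Borders i p) :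
    (T.boundingDiagonals i (offset i p.base)).ncard ≤ l := by
  induction h with
  | one p hend =>
    have hempty : T.boundingDiagonals i (offset i p.tip) = ∅ := by
      refine Set.eq_empty_of_forall_notMem fun d hd => ?_
      obtain ⟨r, r', hrr, hr, hr'⟩ := exists_covBy_of_isConnected hT
        (fun d => ∀ a ∈ d.1, offset i a ≤ offset i p.tip) (d := ⟨d, hd.1.1⟩) (e := p.edge)
        hd.2 fun h => absurd (h p.base (Sym2.mem_mk_left _ _)) (not_le.2 hp.lt)
      have hb : r.base = r'.base := hrr.elim (fun h => h.lt.1) fun h => h.lt.1.symm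
      have h₁ := hr r.base (Sym2.mem_mk_left _ _)
      have h₂ := hr r.tip (Sym2.mem_mk_right _ _)
      have h₃ : offset i p.tip < offset i r'.tip := by
        by_contra h₃
        refine hr' fun a ha => ?_
        rcases Sym2.mem_iff.1 ha with rfl | rfl
        · rwa [← hb]
        · exact not_lt.1 h₃
      have h₄ := point_mem_segmentTile.1 hp.tip_mem r.base r'.tip (hb ▸ r'.mem)
      have h₅ : r.base = p.tip := offset_injective i (by omega)
      have h₆ : offset i r.base ≠ offset i r.tip := fun h₆ =>
        r.base_ne_tip (offset_injective i h₆)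
      have h₇ := hp.lt
      refine hend r ⟨h₅.symm, (sbtw_iff_offset i).2 ?_⟩
      rw [fanSystem_swap, Dart.base_swap, Dart.tip_swap]
      rw [h₅] at h₆
      omega
    rw [hp.boundingDiagonals_eq, hempty, insert_empty_eq, Set.ncard_singleton]
  | succ p q l hpq _ ih =>
    obtain ⟨hq, hb⟩ := hp.next hpq
    rw [hp.boundingDiagonals_eq, ← hb]
    exact (Set.ncard_insert_le _ _).trans (Nat.succ_le_succ (ih hq))

lemma boundingDiagonals_subset (i : Fin n) (m : ℕ) :
    T.boundingDiagonals i m ⊆ {d | T.Bounds d (T.segmentTile i)} := fun _ hd => hd.1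

/-- The chain that starts at the first dart of a marked point lies on the boundary of an open
tile. -/
lemma exists_isOpenTile_of_chain {p : T.Dart} {l : ℕ} (hp : ∀ r, ¬ r < p)
    (h : T.fanSystem.Chain p l) : ∃ R, T.IsOpenTile R ∧ l ≤ T.tileLength R := by
  refine ⟨T.segmentTile p.base, ⟨isTile_segmentTile _, _, segment_mem_segmentTile _⟩, ?_⟩
  refine (le_ncard_of_chain h (borders_of_minimal hp fun q => offset_le_offset_self _ _)).trans ?_
  exact Set.ncard_le_ncard (boundingDiagonals_subset _ _)
    (T.diagonals.finite_toSet.subset fun d hd => hd.1)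

/-- In a connected tiling, the diagonals that bound an open tile form a single chain. -/
lemma exists_chain_of_isOpenTile (hT : T.IsConnected) {R : Set (BoundaryPiece n)}
    (hR : T.IsOpenTile R) (hpos : 0 < T.tileLength R) :
    ∃ (p : T.Dart) (l : ℕ), (∀ r, ¬ r < p) ∧ T.fanSystem.Chain p l ∧ T.tileLength R ≤ l := by
  obtain ⟨hR, i, hi⟩ := hR
  obtain rfl := eq_segmentTile hR hi
  obtain ⟨d, hd⟩ := Set.nonempty_of_ncard_ne_zero hpos.ne'
  obtain ⟨q₀, -⟩ := Dart.exists_edge_eq ⟨d, hd.1⟩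
  have : Nonempty T.Dart := ⟨q₀⟩
  obtain ⟨q, hq⟩ := Finite.exists_max fun q : T.Dart => offset i q.base
  obtain ⟨p, hpq, hp⟩ := FanSystem.exists_minimal_le q
  have hb : p.base = q.base := Dart.comparable_iff.1 (Or.inl hpq)
  have hmax : ∀ r : T.Dart, offset i r.base ≤ offset i p.base := fun r => hb ▸ hq r
  obtain ⟨l, hl⟩ := T.fanSystem.exists_chain hp
  refine ⟨p, l, hp, hl, le_trans ?_ (ncard_le_of_chain hT hl (borders_of_minimal hp hmax))⟩
  refine Set.ncard_le_ncard (fun d hd => ⟨hd, fun a ha => ?_⟩) (finite_boundingDiagonals _ _)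
  obtain ⟨b, rfl⟩ := Sym2.mem_iff_exists.1 ha
  exact hmax (Dart.mk hd.1)

end Tiling
end MarkedDisc

end

theorem lemma4p3 {K : Type u} [Field K] [IsAlgClosed K] {n : ℕ} (T : MarkedDisc.Tiling n)
    (hconn : T.IsConnected)
    (hopen : ∃ R, T.IsOpenTile R ∧ 2 ≤ T.tileLength R)
    (k : ℕ) (hk : IsGreatest {l | ∃ R, T.IsOpenTile R ∧ T.tileLength R = l} k) :
    HasGorensteinDimension (T.tilingAlgebra K) (k - 1) := by
  obtain ⟨R₀, hR₀, h₂⟩ := hopen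
  have hk₂ : 2 ≤ k := h₂.trans (hk.2 ⟨R₀, hR₀, rfl⟩)
  have hle (p : T.Dart) (l : ℕ) (hp : ∀ r, ¬ r < p) (hl : T.fanSystem.Chain p l) : l ≤ k := by
    obtain ⟨R, hR, hlR⟩ := MarkedDisc.Tiling.exists_isOpenTile_of_chain hp hl
    exact hlR.trans (hk.2 ⟨R, hR, rfl⟩)
  refine (MarkedDisc.Tiling.realization K T).hasGorensteinDimension hk₂ hle ?_
  obtain ⟨R, hR, hRk⟩ := hk.1
  obtain ⟨p, l, hp, hl, hRl⟩ := MarkedDisc.Tiling.exists_chain_of_isOpenTile hconn hR (by omega)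
  obtain rfl : l = k := le_antisymm (hle p l hp hl) (hRk ▸ hRl)
  exact ⟨p, hp, hl⟩
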